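/- **Setting.** Consider $N$ agents, $i\in\mathcal N=\{1,\dots,N\}$, with $$\dot x_i=A_ix_i+B_iu_i+E_i\omega,\qquad y_i=C_ix_i+D_iu_i,\qquad y_{\mathrm mi}=C_{\mathrm mi}x_i+D_{\mathrm mi}u_i,\qquad e_i=y_i-y_0,\quad y_0=R\omega,\qquad t\ge 0,$$ where $x_i\in\mathbb R^{n_i}$, $u_i\in\mathbb R^{m_i}$, $y_i\in\mathbb R^p$, $y_{\mathrm mi}\in\mathbb R^{p_i}$, $\omega=[r_0^{\mathrm T},\delta^{\mathrm T}]^{\mathrm T}\in\mathbb R^{q}$ is an exogenous signal, $E_i=[0\ \ E_{\delta_i}]$ and $R=[R_{\mathrm r}\ \ 0]$. The agents communicate over a fixed directed graph with weights $a_{ij}\ge 0$ ($a_{ij}>0$ iff there is an edge from $v_j$ to $v_i$; $a_{ii}=0$), augmented by a leader node $v_0$ with an edge $(v_0,v_i)$ of weight $k_i>0$ if agent $i$ observes the leader, and $k_i=0$ otherwise. Put $d_i=\sum_j a_{ij}$ and $$e_{\mathrm vi}=\frac1{d_i+k_i}\Big[\sum_{j}a_{ij}(y_i-y_j)+k_i(y_i-y_0)\Big].$$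 The control law is dynamic output feedback with local measurement, $u_i=\bar K_iz_i$, $\dot z_i=M_{1i}z_i+M_{2i}e_{\mathrm vi}+M_{3i}y_{\mathrm mi}$, with $z_i=[\hat x_i^{\mathrm T},\bar z_i^{\mathrm T}]^{\mathrm T}$, $\bar K_i=[K_{1i}\ \ K_{2i}]$ and $$M_{1i}=\begin{bmatrix}A_i+B_iK_{1i}-H_i(C_{\mathrm mi}+D_{\mathrm mi}K_{1i})&(B_i-H_iD_{\mathrm mi})K_{2i}\\0&G_{1i}\end{bmatrix},\quad M_{2i}=\begin{bmatrix}0\\G_{2i}\end{bmatrix},\quad M_{3i}=\begin{bmatrix}H_i\\0\end{bmatrix},$$ that is, a Luenberger observer $\hat x_i$ of $x_i$ together with $\dot{\bar z}_i=G_{1i}\bar z_i+G_{2i}e_{\mathrm vi}$. A real square matrix is called Hurwitz if all its eigenvalues have negative real parts. Let $A,B,C,D,K_1,K_2,G_1,G_2$ be the block-diagonal matrices formed from the agents' matrices, let $\mathcal A=[a_{ij}]$, $\mathcal F=\mathrm{diag}\big(\tfrac1{d_1+k_1},\dots,\tfrac1{d_N+k_N}\big)$, $\mathcal W=(I_N-\mathcal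 F\mathcal A)\otimes I_p$ and $$A_{\mathrm g}=\begin{bmatrix}A+BK_1&BK_2\\G_2\mathcal W(C+DK_1)&G_1+G_2\mathcal WDK_2\end{bmatrix}.$$ **Theorem.** Let $A_0\in\mathbb R^{q\times q}$ and assume: 1. $A_0$ has no eigenvalue with negative real part; 2. $\omega$ is continuous on $[0,\infty)$ with piecewise continuous derivative $\dot\omega$, and there is $\kappa>0$ with $\|A_0\omega(t)-\dot\omega(t)\|_2\le\kappa$ for all $t\ge0$; 3. the augmented directed graph has a spanning tree rooted at the leader $v_0$, that is, there is a directed path from $v_0$ to every $v_i$; 4. for every $i$, $(G_{1i},G_{2i},0)$ incorporates a $p$-copy internal model of $A_0$: $G_{1i}=\mathrm{diag}(\beta_1,\dots,\beta_p)$ and $G_{2i}=\mathrm{diag}(\sigma_1,\dots,\sigma_p)$, where $\beta_l\in\mathbb R^{s_l\times s_l}$ and $\sigma_l\in\mathbb R^{s_l}$ may depend on $i$, each pair $(\beta_l,\sigma_l)$ is controllable, and the characteristic polynomial of each $\beta_l$ equals the minimal polynomial of $A_0$; 5. $A_{\mathrm g}$ is Hurwitz, and $A_i-H_iC_{\mathrm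 mi}$ is Hurwitz for every $i\in\mathcal N$. Then the control law above solves the cooperative output regulation problem: a) the system matrix of the closed-loop system, with state $(x_1,\dots,x_N,z_1,\dots,z_N)$, is Hurwitz; b) every initial condition of the closed-loop system has a solution on $[0,\infty)$, and the tracking errors are ultimately bounded: there is $b>0$ such that for every initial condition there is $T\ge0$ with $\|e_i(t)\|_2\le b$ for all $t\ge T$ and all $i\in\mathcal N$; c) if $\lim_{t\to\infty}\big(A_0\omega(t)-\dot\omega(t)\big)=0$, then for every initial condition $\lim_{t\to\infty}e_i(t)=0$ for all $i\in\mathcal N$. -/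

import Mathlib

open Set Filter Topology
open scoped Matrix Kronecker

noncomputable section

namespace CoopReg

/-! ### Matrix notions -/

/-- The spectrum (set of complex eigenvalues) of a real square matrix. -/
def complexSpectrum {ι : Type} [Fintype ι] [DecidableEq ι] (M : Matrix ι ι ℝ) : Set ℂ :=
  spectrum ℂ (M.map (fun r : ℝ => (r : ℂ)))

/-- A real square matrix is Hurwitz if all its eigenvalues have negative real parts. -/
def IsHurwitz {ι : Type} [Fintype ι] [DecidableEq ι] (M : Matrix ι ι ℝ) : Prop :=
  ∀ s ∈ complexSpectrum M, s.re < 0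

/-- A real square matrix has no eigenvalues with negative real parts. -/
def NoStableEigenvalue {ι : Type} [Fintype ι] [DecidableEq ι] (M : Matrix ι ι ℝ) : Prop :=
  ∀ s ∈ complexSpectrum M, 0 ≤ s.re

/-- The Euclidean norm of a real vector. -/
def norm2 {ι : Type} [Fintype ι] (v : ι → ℝ) : ℝ :=
  ‖(WithLp.toLp 2 v : EuclideanSpace ℝ ι)‖

/-- Controllability of a single-input pair `(β, σ)`: the controllability matrix
`[σ, β σ, …, β ^ (s - 1) σ]` has rank `s`. -/
def IsControllable {s : ℕ} (β : Matrix (Fin s) (Fin s) ℝ) (σ : Fin s → ℝ) : Prop :=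
  (Matrix.of fun (a k : Fin s) => ((β ^ (k : ℕ)) *ᵥ σ) a).rank = s

/-- `(G₁, G₂, 0)` incorporates a `p`-copy internal model of `A₀`:
`G₁ = diag (β₁, …, β_p)` and `G₂ = diag (σ₁, …, σ_p)` (each `σ_l` being a column), where
every pair `(β_l, σ_l)` is controllable and the characteristic polynomial of `β_l` is the
minimal polynomial of `A₀`. -/
def IncorporatesInternalModel {ι : Type} [Fintype ι] [DecidableEq ι] {p r : ℕ}
    (A₀ : Matrix ι ι ℝ) (G₁ : Matrix (Fin r) (Fin r) ℝ) (G₂ : Matrix (Fin r) (Fin p) ℝ) : Prop :=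
  ∃ (s : Fin p → ℕ) (hs : ∑ l, s l = r)
    (β : (l : Fin p) → Matrix (Fin (s l)) (Fin (s l)) ℝ) (σ : (l : Fin p) → Fin (s l) → ℝ),
    -- the canonical enumeration of the `∑ l, s l = r` rows, block after block
    let row : (Σ l : Fin p, Fin (s l)) ≃ Fin r := finSigmaFinEquiv.trans (finCongr hs)
    G₁ = Matrix.reindex row row (Matrix.blockDiagonal' β) ∧
    G₂ = (Matrix.of fun (a : Σ l : Fin p, Fin (s l)) (l : Fin p) =>
      if a.1 = l then σ a.1 a.2 else 0).submatrix row.symm id ∧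
    ∀ l, IsControllable (β l) (σ l) ∧ minpoly ℝ A₀ = (β l).charpoly

/-! ### The communication graph -/

/-- The weights of a fixed augmented directed graph with followers `v_i`, `i : Fin N`, and a
leader `v_0`: `adj i j > 0` iff there is an edge from `v_j` to `v_i`, and `pin i > 0` iff there
is an edge from `v_0` to `v_i`. -/
structure AugmentedGraph (N : ℕ) where
  adj : Matrix (Fin N) (Fin N) ℝ
  pin : Fin N → ℝ
  adj_nonneg : ∀ i j, 0 ≤ adj i j
  adj_self : ∀ i, adj i i = 0
  pin_nonneg : ∀ i, 0 ≤ pin i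

namespace AugmentedGraph

variable {N : ℕ} (𝒢 : AugmentedGraph N)

/-- The augmented directed graph itself; `none` is the leader. `Adj v w` is an edge
from `v` to `w`. -/
def toDigraph : Digraph (Option (Fin N)) where
  Adj v w := match v, w with
    | none, some i => 0 < 𝒢.pin i
    | some j, some i => 0 < 𝒢.adj i j
    | _, none => False

/-- There is a spanning tree rooted at the leader: the leader has directed paths to
all other nodes. -/
def HasSpanningTree : Prop :=
  ∀ i : Fin N, Relation.TransGen 𝒢.toDigraph.Adj none (some i)

/-- The in-degree `d_i` of a follower (non-neighbours contribute `0`). -/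
def deg (i : Fin N) : ℝ := ∑ j, 𝒢.adj i j

/-- `diag (1 / (d_1 + k_1), …, 1 / (d_N + k_N))`. -/
def scaling : Matrix (Fin N) (Fin N) ℝ :=
  Matrix.diagonal fun i => 1 / (𝒢.deg i + 𝒢.pin i)

/-- `𝒲 = (I_N - ℱ 𝒜) ⊗ I_p`. -/
def W (p : ℕ) : Matrix (Σ _ : Fin N, Fin p) (Σ _ : Fin N, Fin p) ℝ :=
  ((1 - 𝒢.scaling * 𝒢.adj) ⊗ₖ (1 : Matrix (Fin p) (Fin p) ℝ)).submatrix
    (Equiv.sigmaEquivProd (Fin N) (Fin p)) (Equiv.sigmaEquivProd (Fin N) (Fin p))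

end AugmentedGraph

/-! ### Agents, exogenous signals and controllers -/

/-- An agent `x' = A x + B u + Eδ δ`, `y = C x + D u`, with local measurement
`y_m = Cm x + Dm u`. -/
structure Agent (p qδ : ℕ) where
  n : ℕ
  m : ℕ
  pm : ℕ
  A : Matrix (Fin n) (Fin n) ℝ
  B : Matrix (Fin n) (Fin m) ℝ
  C : Matrix (Fin p) (Fin n) ℝ
  D : Matrix (Fin p) (Fin m) ℝ
  Eδ : Matrix (Fin n) (Fin qδ) ℝ
  Cm : Matrix (Fin pm) (Fin n) ℝ
  Dm : Matrix (Fin pm) (Fin m) ℝ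

/-- `E = [0  Eδ]`, acting on the exogenous signal `ω = (r₀, δ)`. -/
def Agent.E {p qδ : ℕ} (a : Agent p qδ) (qr : ℕ) : Matrix (Fin a.n) (Fin qr ⊕ Fin qδ) ℝ :=
  Matrix.fromCols 0 a.Eδ

/-- A network of `N` heterogeneous agents, over an augmented directed graph, with
reference output `y₀ = Rr r₀`. -/
structure Network (N p qr qδ : ℕ) where
  graph : AugmentedGraph N
  agent : Fin N → Agent p qδ
  Rr : Matrix (Fin p) (Fin qr) ℝ

/-- `R = [Rr  0]`, acting on the exogenous signal `ω = (r₀, δ)`. -/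
def Network.R {N p qr qδ : ℕ} (S : Network N p qr qδ) : Matrix (Fin p) (Fin qr ⊕ Fin qδ) ℝ :=
  Matrix.fromCols S.Rr 0

/-- A dynamic output feedback law with local measurement, with controller state indexed by `ζ`:
`u = K z`, `z' = M₁ z + M₂ e_v + M₃ y_m`. -/
structure OutputFeedback {p qδ : ℕ} (a : Agent p qδ) (ζ : Type) where
  K : Matrix (Fin a.m) ζ ℝ
  M₁ : Matrix ζ ζ ℝ
  M₂ : Matrix ζ (Fin p) ℝ
  M₃ : Matrix ζ (Fin a.pm) ℝ

/-- The design matrices of one agent: feedback gains `K₁`, `K₂`, internal model `(G₁, G₂)`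
and observer gain `H`. -/
structure Gains {p qδ : ℕ} (a : Agent p qδ) where
  r : ℕ
  K₁ : Matrix (Fin a.m) (Fin a.n) ℝ
  K₂ : Matrix (Fin a.m) (Fin r) ℝ
  G₁ : Matrix (Fin r) (Fin r) ℝ
  G₂ : Matrix (Fin r) (Fin p) ℝ
  H : Matrix (Fin a.n) (Fin a.pm) ℝ

/-- The law with state `z = (x̂, z̄)` made of `u = K₁ x̂ + K₂ z̄`, the Luenberger observer
`x̂' = A x̂ + B u + H (y_m - Cm x̂ - Dm u)` and the internal model `z̄' = G₁ z̄ + G₂ e_v`. -/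
def Gains.toFeedback {p qδ : ℕ} {a : Agent p qδ} (g : Gains a) :
    OutputFeedback a (Fin a.n ⊕ Fin g.r) where
  K := Matrix.fromCols g.K₁ g.K₂
  M₁ := Matrix.fromBlocks
    (a.A + a.B * g.K₁ - g.H * (a.Cm + a.Dm * g.K₁)) ((a.B - g.H * a.Dm) * g.K₂)
    0 g.G₁
  M₂ := Matrix.fromRows 0 g.G₂
  M₃ := Matrix.fromRows g.H 0

/-! ### Exogenous signals -/

/-- `f` is piecewise continuous on `[0, ∞)`: on bounded subintervals it has finitely many
discontinuities, and at each of them both one-sided limits exist (at `0` only the right one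
is a condition). -/
def PiecewiseContinuous {ι : Type} (f : ℝ → ι → ℝ) : Prop :=
  (∀ T : ℝ, {t ∈ Icc 0 T | ¬ ContinuousWithinAt f (Ici 0) t}.Finite) ∧
  ∀ t : ℝ, 0 ≤ t → ¬ ContinuousWithinAt f (Ici 0) t →
    (∃ l, Tendsto f (𝓝[>] t) (𝓝 l)) ∧ (∃ l, Tendsto f (𝓝[Ico 0 t] t) (𝓝 l))

/-- `ω` is a continuous signal on `[0, ∞)` with piecewise continuous time derivative `ω'`
(the derivative is not required to exist where `ω'` jumps). -/
structure HasPiecewiseDeriv {ι : Type} [Fintype ι] (ω ω' : ℝ → ι → ℝ) : Prop where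
  continuousOn : ContinuousOn ω (Ici 0)
  piecewise : PiecewiseContinuous ω'
  hasDeriv : ∀ t : ℝ, 0 ≤ t → ContinuousWithinAt ω' (Ici 0) t →
    HasDerivWithinAt ω (ω' t) (Ici 0) t

/-- The exogenous signal has a piecewise continuous derivative and `A₀ ω - ω'` is bounded. -/
def IsAdmissibleSignal {ι : Type} [Fintype ι] (A₀ : Matrix ι ι ℝ) (ω ω' : ℝ → ι → ℝ) : Prop :=
  HasPiecewiseDeriv ω ω' ∧ ∃ κ : ℝ, 0 < κ ∧ ∀ t : ℝ, 0 ≤ t → norm2 (A₀ *ᵥ ω t - ω' t) ≤ κ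

/-! ### The closed-loop system -/

namespace Network

variable {N p qr qδ : ℕ} (S : Network N p qr qδ)

section Signals

variable {ζ : Fin N → Type} [∀ i, Fintype (ζ i)]
  (c : (i : Fin N) → OutputFeedback (S.agent i) (ζ i))
  (ω : ℝ → Fin qr ⊕ Fin qδ → ℝ)
  (x : (i : Fin N) → ℝ → Fin (S.agent i).n → ℝ) (z : (i : Fin N) → ℝ → ζ i → ℝ)

/-- The input `u_i`. -/
def input (i : Fin N) (t : ℝ) : Fin (S.agent i).m → ℝ := (c i).K *ᵥ z i t

/-- The output `y_i`. -/
def output (i : Fin N) (t : ℝ) : Fin p → ℝ :=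
  (S.agent i).C *ᵥ x i t + (S.agent i).D *ᵥ S.input c z i t

/-- The local measurement `y_mi`. -/
def measurement (i : Fin N) (t : ℝ) : Fin (S.agent i).pm → ℝ :=
  (S.agent i).Cm *ᵥ x i t + (S.agent i).Dm *ᵥ S.input c z i t

/-- The reference output `y₀`. -/
def reference (t : ℝ) : Fin p → ℝ := S.R *ᵥ ω t

/-- The tracking error `e_i = y_i - y₀`. -/
def trackingError (i : Fin N) (t : ℝ) : Fin p → ℝ :=
  S.output c x z i t - S.reference ω t

/-- The local virtual tracking error `e_vi` (non-neighbours have weight `0`). -/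
def virtualError (i : Fin N) (t : ℝ) : Fin p → ℝ :=
  (1 / (S.graph.deg i + S.graph.pin i)) •
    (∑ j, S.graph.adj i j • (S.output c x z i t - S.output c x z j t) +
      S.graph.pin i • (S.output c x z i t - S.reference ω t))

/-- `(x, z)` is a solution on `[0, ∞)` of the closed-loop system with exogenous signal `ω`. -/
structure IsTrajectory : Prop where
  plant : ∀ i, ∀ t : ℝ, 0 ≤ t → HasDerivWithinAt (x i)
    ((S.agent i).A *ᵥ x i t + (S.agent i).B *ᵥ S.input c z i t + (S.agent i).E qr *ᵥ ω t)
    (Ici 0) t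
  controller : ∀ i, ∀ t : ℝ, 0 ≤ t → HasDerivWithinAt (z i)
    ((c i).M₁ *ᵥ z i t + (c i).M₂ *ᵥ S.virtualError c ω x z i t +
      (c i).M₃ *ᵥ S.measurement c x z i t)
    (Ici 0) t

end Signals

/-! Block-diagonal matrices of the network. -/

def A := Matrix.blockDiagonal' fun i => (S.agent i).A
def B := Matrix.blockDiagonal' fun i => (S.agent i).B
def C := Matrix.blockDiagonal' fun i => (S.agent i).C
def D := Matrix.blockDiagonal' fun i => (S.agent i).D
def Cm := Matrix.blockDiagonal' fun i => (S.agent i).Cm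
def Dm := Matrix.blockDiagonal' fun i => (S.agent i).Dm

/-- The system matrix of the closed-loop system, for the state `(x, z)` with
`x = (x_1, …, x_N)` and `z = (z_1, …, z_N)`. -/
def closedLoopMatrix {ζ : Fin N → Type} [∀ i, Fintype (ζ i)]
    (c : (i : Fin N) → OutputFeedback (S.agent i) (ζ i)) :
    Matrix ((Σ i, Fin (S.agent i).n) ⊕ (Σ i, ζ i)) ((Σ i, Fin (S.agent i).n) ⊕ (Σ i, ζ i)) ℝ :=
  let K := Matrix.blockDiagonal' fun i => (c i).K
  let M₁ := Matrix.blockDiagonal' fun i => (c i).M₁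
  let M₂ := Matrix.blockDiagonal' fun i => (c i).M₂
  let M₃ := Matrix.blockDiagonal' fun i => (c i).M₃
  Matrix.fromBlocks
    S.A (S.B * K)
    (M₂ * S.graph.W p * S.C + M₃ * S.Cm) (M₁ + M₂ * S.graph.W p * S.D * K + M₃ * S.Dm * K)

/-- The matrix `A_g`: the system matrix that the network would have under the state feedback
`u_i = K_{1i} x_i + K_{2i} z̄_i` with `z̄_i' = G_{1i} z̄_i + G_{2i} e_vi`. -/
def Ag (g : (i : Fin N) → Gains (S.agent i)) :
    Matrix ((Σ i, Fin (S.agent i).n) ⊕ (Σ i, Fin (g i).r))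
      ((Σ i, Fin (S.agent i).n) ⊕ (Σ i, Fin (g i).r)) ℝ :=
  let K₁ := Matrix.blockDiagonal' fun i => (g i).K₁
  let K₂ := Matrix.blockDiagonal' fun i => (g i).K₂
  let G₁ := Matrix.blockDiagonal' fun i => (g i).G₁
  let G₂ := Matrix.blockDiagonal' fun i => (g i).G₂
  Matrix.fromBlocks
    (S.A + S.B * K₁) (S.B * K₂)
    (G₂ * S.graph.W p * (S.C + S.D * K₁)) (G₁ + G₂ * S.graph.W p * S.D * K₂)

/-- The control law `c` solves the cooperative output regulation problem for the network `S`,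
the matrix `A₀` and the exogenous signal `ω` with derivative `ω'`. -/
structure SolvesRegulation {ζ : Fin N → Type} [∀ i, Fintype (ζ i)] [∀ i, DecidableEq (ζ i)]
    (c : (i : Fin N) → OutputFeedback (S.agent i) (ζ i))
    (A₀ : Matrix (Fin qr ⊕ Fin qδ) (Fin qr ⊕ Fin qδ) ℝ)
    (ω ω' : ℝ → Fin qr ⊕ Fin qδ → ℝ) : Prop where
  /-- The closed-loop system matrix is Hurwitz. -/
  hurwitz : IsHurwitz (S.closedLoopMatrix c)
  /-- Every initial condition has a closed-loop solution on `[0, ∞)`. -/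
  exists_trajectory : ∀ (x₀ : (i : Fin N) → Fin (S.agent i).n → ℝ) (z₀ : (i : Fin N) → ζ i → ℝ),
    ∃ x z, S.IsTrajectory c ω x z ∧ (∀ i, x i 0 = x₀ i) ∧ (∀ i, z i 0 = z₀ i)
  /-- The tracking errors are ultimately bounded, with one ultimate bound `b` for all initial
  conditions. -/
  ultimately_bounded : ∃ b : ℝ, 0 < b ∧
    ∀ (x₀ : (i : Fin N) → Fin (S.agent i).n → ℝ) (z₀ : (i : Fin N) → ζ i → ℝ),
    ∃ T : ℝ, 0 ≤ T ∧ ∀ x z, S.IsTrajectory c ω x z →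
      (∀ i, x i 0 = x₀ i) → (∀ i, z i 0 = z₀ i) →
      ∀ t : ℝ, T ≤ t → ∀ i, norm2 (S.trackingError c ω x z i t) ≤ b
  /-- If `A₀ ω - ω'` vanishes at infinity, so do the tracking errors, for all initial
  conditions. -/
  regulation : Tendsto (fun t => A₀ *ᵥ ω t - ω' t) atTop (𝓝 0) →
    ∀ x z, S.IsTrajectory c ω x z →
      ∀ i, Tendsto (fun t => S.trackingError c ω x z i t) atTop (𝓝 0)

end Network

end CoopReg

end

/-! Stack the network as `w' = M w + B ω`, `e = C w - R ω`, with `e` the tracking errors; the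
virtual errors are then `𝒲 e`.

Stability is a separation principle. With `ω = 0` the observer error `x̂_i - x_i` is governed by
`A_i - H_i C_mi`, and where it vanishes the loop is governed by `A_g`. An eigenvector of `M` for an
eigenvalue with nonnegative real part would therefore be one for some `A_i - H_i C_mi` or for `A_g`
(`isHurwitz_closedLoopMatrix`).

Hence `M` and `A₀` share no eigenvalue, and the Sylvester equation `M X + B = X A₀` has a solution
(`IsHurwitz.exists_sylvester`). Its internal-model rows read `G₁ Z + G₂ Y = Z A₀`, where `Y` is an
agent's part of `𝒲 (C X - R)`. The internal model forces `Y = 0`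
(`IncorporatesInternalModel.eq_zero`), and the spanning tree makes `𝒲` injective, so `C X = R`.

Finally `d = w - X ω` satisfies `d' = M d + X (A₀ ω - ω')` and `e = C d`. Boundedness and decay of
`e` follow from estimates for Hurwitz systems (`IsHurwitz.exists_ultimate_gain`,
`IsHurwitz.tendsto_zero`), obtained without Jordan form by peeling off the roots of the
characteristic polynomial one at a time. -/

namespace CoopReg

/-! ### Linear differential equations with a Hurwitz matrix -/

/-- Variation of constants bound for the scalar equation `w' = μ w + f`, with right derivatives. -/
theorem norm_le_of_scalar_ode {E : Type*} [NormedAddCommGroup E] [NormedSpace ℂ E]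
    {w f : ℝ → E} {μ : ℂ} (hμ : μ.re < 0) {T b : ℝ}
    (hw : ContinuousOn w (Ici T))
    (hd : ∀ t, T ≤ t → HasDerivWithinAt w (μ • w t + f t) (Ici t) t)
    (hb : ∀ t, T ≤ t → ‖f t‖ ≤ b) {t : ℝ} (ht : T ≤ t) :
    ‖w t‖ ≤ Real.exp (μ.re * (t - T)) * ‖w T‖ + b / (-μ.re) := by
  let : NormedSpace ℝ E := NormedSpace.restrictScalars ℝ ℂ E
  have hb0 : 0 ≤ b := (norm_nonneg _).trans (hb T le_rfl)
  -- Integrating factor: `φ • w` has right derivative `φ • f`, whose norm is at most the derivative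
  -- of the comparison function in `hB`.
  set φ : ℝ → ℂ := fun s => Complex.exp (-μ * ((s - T : ℝ) : ℂ)) with hφ
  have hφd : ∀ s, HasDerivAt φ (-μ * φ s) s := by
    intro s
    have h1 : HasDerivAt (fun s : ℝ => -μ * ((s - T : ℝ) : ℂ)) (-μ) s := by
      have := (((hasDerivAt_id s).sub_const T).ofReal_comp).const_mul (-μ)
      simpa using this
    have := h1.cexp
    rw [mul_comm] at this
    exact this
  have hφn : ∀ s, ‖φ s‖ = Real.exp (-μ.re * (s - T)) := by
    intro s
    simp [hφ, Complex.norm_exp]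
  have hB : ∀ s : ℝ, HasDerivAt
      (fun s => ‖w T‖ + b / (-μ.re) * (Real.exp (-μ.re * (s - T)) - 1))
      (b * Real.exp (-μ.re * (s - T))) s := by
    intro s
    have h1 : HasDerivAt (fun s : ℝ => -μ.re * (s - T)) (-μ.re) s := by
      simpa using ((hasDerivAt_id s).sub_const T).const_mul (-μ.re)
    have := ((h1.exp.sub_const 1).const_mul (b / (-μ.re))).const_add ‖w T‖
    refine this.congr_deriv ?_
    have : μ.re ≠ 0 := hμ.ne
    field_simp
  have key := image_norm_le_of_norm_deriv_right_le_deriv_boundary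
    (f := fun s => φ s • w s) (f' := fun s => φ s • f s) (a := T) (b := t)
    (ContinuousOn.smul (fun s _ => (hφd s).continuousAt.continuousWithinAt)
      (hw.mono Icc_subset_Ici_self))
    (by
      intro s hs
      refine ((hφd s).hasDerivWithinAt.smul (hd s hs.1) (s := Ici s)).congr_deriv ?_
      rw [smul_add, smul_smul, add_right_comm, ← add_smul]
      simp [mul_comm])
    (B := fun s => ‖w T‖ + b / (-μ.re) * (Real.exp (-μ.re * (s - T)) - 1))
    (B' := fun s => b * Real.exp (-μ.re * (s - T)))
    (by simp [hφ]) hB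
    (by
      intro s hs
      rw [norm_smul, hφn, mul_comm]
      exact mul_le_mul_of_nonneg_right (hb s hs.1) (Real.exp_pos _).le)
    (right_mem_Icc.2 ht)
  simp only [norm_smul, hφn] at key
  have he : Real.exp (μ.re * (t - T)) * Real.exp (-μ.re * (t - T)) = 1 := by
    rw [← Real.exp_add]; simp
  have h2 := mul_le_mul_of_nonneg_left key (Real.exp_pos (μ.re * (t - T))).le
  rw [← mul_assoc, he, one_mul] at h2
  have h3 : 0 ≤ b / (-μ.re) := div_nonneg hb0 (by linarith)
  have h4 := Real.exp_pos (μ.re * (t - T))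
  calc ‖w t‖ ≤ _ := h2
    _ = Real.exp (μ.re * (t - T)) * ‖w T‖ + b / (-μ.re) *
        (Real.exp (μ.re * (t - T)) * Real.exp (-μ.re * (t - T)))
          - b / (-μ.re) * Real.exp (μ.re * (t - T)) := by ring
    _ ≤ _ := by rw [he]; nlinarith [mul_nonneg h3 h4.le]

/-- Start the clock once the bound on `f` is in force; the transient from that moment decays below
`ε`. -/
theorem eventually_norm_le_of_scalar_ode {E : Type*} [NormedAddCommGroup E] [NormedSpace ℂ E]
    {w f : ℝ → E} {μ : ℂ} (hμ : μ.re < 0) {b : ℝ}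
    (hw : ContinuousOn w (Ici 0))
    (hd : ∀ t, 0 ≤ t → HasDerivWithinAt w (μ • w t + f t) (Ici t) t)
    (hb : ∀ᶠ t in atTop, ‖f t‖ ≤ b) {ε : ℝ} (hε : 0 < ε) :
    ∀ᶠ t in atTop, ‖w t‖ ≤ b / (-μ.re) + ε := by
  obtain ⟨T₀, hT₀⟩ := eventually_atTop.1 hb
  set T := max T₀ 0
  have h := fun t (ht : T ≤ t) => norm_le_of_scalar_ode hμ (T := T) (b := b)
    (hw.mono (Ici_subset_Ici.2 (le_max_right _ _)))
    (fun t ht => hd t ((le_max_right _ _).trans ht))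
    (fun t ht => hT₀ t ((le_max_left _ _).trans ht)) ht
  have hlim : Tendsto (fun t => Real.exp (μ.re * (t - T)) * ‖w T‖) atTop (𝓝 (0 * ‖w T‖)) := by
    refine Tendsto.mul_const _ (Real.tendsto_exp_atBot.comp ?_)
    exact Tendsto.const_mul_atTop_of_neg hμ (tendsto_atTop_add_const_right _ _ tendsto_id)
  rw [zero_mul] at hlim
  filter_upwards [hlim.eventually (gt_mem_nhds hε), eventually_ge_atTop T] with t h1 h2
  linarith [h t h2]

theorem exists_norm_mulVec_le {m n 𝕜 : Type*} [Fintype m] [Fintype n] [RCLike 𝕜]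
    (M : Matrix m n 𝕜) : ∃ c : ℝ, 0 ≤ c ∧ ∀ v, ‖M *ᵥ v‖ ≤ c * ‖v‖ :=
  ⟨_, norm_nonneg _, fun v => (LinearMap.toContinuousLinearMap M.mulVecLin).le_opNorm v⟩

theorem hasDerivWithinAt_mulVec {m n 𝕜 : Type*} [Fintype m] [Fintype n] [RCLike 𝕜]
    (M : Matrix m n 𝕜) {w : ℝ → n → 𝕜} {w' : n → 𝕜} {s : Set ℝ} {t : ℝ}
    (h : HasDerivWithinAt w w' s t) :
    HasDerivWithinAt (fun t => M *ᵥ w t) (M *ᵥ w') s t := by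
  rw [hasDerivWithinAt_pi] at h ⊢
  intro i
  exact HasDerivWithinAt.fun_sum fun j _ => (h j).const_mul (M i j)

theorem continuousOn_mulVec {m n 𝕜 : Type*} [Fintype m] [Fintype n] [RCLike 𝕜]
    (M : Matrix m n 𝕜) {w : ℝ → n → 𝕜} {s : Set ℝ} (h : ContinuousOn w s) :
    ContinuousOn (fun t => M *ᵥ w t) s :=
  (LinearMap.toContinuousLinearMap M.mulVecLin).continuous.comp_continuousOn h

/-- If a product of factors `M - μ` with `Re μ < 0` annihilates a solution of `w' = M w + f`,
then the solution is ultimately bounded by a multiple of any ultimate bound of `f`. -/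
theorem exists_ultimate_gain_of_annihilated {ι : Type*} [Fintype ι] [DecidableEq ι]
    (M : Matrix ι ι ℂ) (s : Multiset ℂ) (hs : ∀ μ ∈ s, μ.re < 0) :
    ∃ c : ℝ, 0 ≤ c ∧ ∀ (w f : ℝ → ι → ℂ) (b : ℝ), 0 ≤ b → ContinuousOn w (Ici 0) →
      (∀ t, 0 ≤ t → HasDerivWithinAt w (M *ᵥ w t + f t) (Ici t) t) →
      (∀ t, 0 ≤ t →
        Polynomial.aeval M (s.map fun μ => Polynomial.X - Polynomial.C μ).prod *ᵥ w t = 0) →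
      (∀ᶠ t in atTop, ‖f t‖ ≤ b) → ∀ ε, 0 < ε → ∀ᶠ t in atTop, ‖w t‖ ≤ c * b + ε := by
  induction s using Multiset.induction_on with
  | empty =>
    refine ⟨0, le_rfl, fun w f b _ _ _ h0 _ ε hε => ?_⟩
    filter_upwards [eventually_ge_atTop 0] with t ht
    have := h0 t ht
    simp at this
    simp [this, hε.le]
  | cons μ s ih =>
    obtain ⟨c, hc, h⟩ := ih fun ν hν => hs ν (Multiset.mem_cons_of_mem hν)
    have hμ := hs μ (Multiset.mem_cons_self _ _)
    -- `L` commutes with `M`, so `L w` solves the same equation with forcing `L f` and is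
    -- annihilated by the shorter product. Once `L w` is bounded, `w' = μ w + (L w + f)` is a scalar
    -- equation.
    set L : Matrix ι ι ℂ := M - algebraMap ℂ _ μ with hL
    obtain ⟨k, hk, hkL⟩ := exists_norm_mulVec_le L
    have hcomm : L * M = M * L := by
      rw [hL, sub_mul, mul_sub, Algebra.commutes]
    -- The forcing `L w + f` is ultimately at most `c * (k * b) + b`, up to an error; the scalar
    -- equation divides by `-μ.re`.
    refine ⟨(c * k + 1) / (-μ.re), by apply div_nonneg <;> [positivity; linarith], ?_⟩
    intro w f b hb hw hd h0 hf ε hε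
    have hε' : 0 < ε / 2 * (-μ.re) := mul_pos (half_pos hε) (by linarith)
    have h1 := h (fun t => L *ᵥ w t) (fun t => L *ᵥ f t) (k * b) (by positivity)
      (continuousOn_mulVec L hw)
      (fun t ht => by
        have := hasDerivWithinAt_mulVec L (hd t ht)
        rwa [Matrix.mulVec_add, Matrix.mulVec_mulVec, hcomm, ← Matrix.mulVec_mulVec] at this)
      (fun t ht => by
        have := h0 t ht
        rw [Multiset.map_cons, Multiset.prod_cons, mul_comm, map_mul, ← Matrix.mulVec_mulVec]
          at this
        simpa [hL] using this)
      (by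
        filter_upwards [hf] with t ht
        exact (hkL _).trans (mul_le_mul_of_nonneg_left ht hk)) _ hε'
    have h2 := eventually_norm_le_of_scalar_ode (w := w) (f := fun t => L *ᵥ w t + f t) hμ
      (b := c * (k * b) + ε / 2 * (-μ.re) + b) hw
      (fun t ht => by
        refine (hd t ht).congr_deriv ?_
        simp [hL, Matrix.sub_mulVec, Algebra.algebraMap_eq_smul_one, Matrix.smul_mulVec]
        abel)
      (by
        filter_upwards [h1, hf] with t h1 h2
        exact (norm_add_le _ _).trans (add_le_add h1 h2)) (half_pos hε)
    filter_upwards [h2] with t ht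
    refine ht.trans (le_of_eq ?_)
    have : μ.re ≠ 0 := hμ.ne
    field_simp
    ring

theorem isHurwitz_iff_roots {ι : Type} [Fintype ι] [DecidableEq ι] {M : Matrix ι ι ℝ} :
    IsHurwitz M ↔ ∀ μ ∈ (M.map (fun r : ℝ => (r : ℂ))).charpoly.roots, μ.re < 0 := by
  unfold IsHurwitz complexSpectrum
  simp only [Matrix.mem_spectrum_iff_isRoot_charpoly,
    Polynomial.mem_roots (Matrix.charpoly_monic _).ne_zero]

/-- Ultimate boundedness of the solutions of `w' = M w + f` with `M` Hurwitz. -/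
theorem IsHurwitz.exists_ultimate_gain {ι : Type} [Fintype ι] [DecidableEq ι]
    {M : Matrix ι ι ℝ} (hM : IsHurwitz M) :
    ∃ c : ℝ, 0 ≤ c ∧ ∀ (w f : ℝ → ι → ℝ) (b : ℝ), 0 ≤ b → ContinuousOn w (Ici 0) →
      (∀ t, 0 ≤ t → HasDerivWithinAt w (M *ᵥ w t + f t) (Ici t) t) →
      (∀ᶠ t in atTop, ‖f t‖ ≤ b) → ∀ ε, 0 < ε → ∀ᶠ t in atTop, ‖w t‖ ≤ c * b + ε := by
  set Mc : Matrix ι ι ℂ := M.map (fun r : ℝ => (r : ℂ)) with hMc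
  -- By Cayley–Hamilton, the product over all roots of the characteristic polynomial annihilates
  -- every function.
  obtain ⟨c, hc, h⟩ := exists_ultimate_gain_of_annihilated Mc _ (isHurwitz_iff_roots.1 hM)
  refine ⟨c, hc, fun w f b hb hw hd hf ε hε => ?_⟩
  have hnorm : ∀ v : ι → ℝ, ‖fun i => (v i : ℂ)‖ = ‖v‖ := fun v => by
    simp [Pi.norm_def]
  have := h (fun t i => (w t i : ℂ)) (fun t i => (f t i : ℂ)) b hb
    (continuousOn_pi.2 fun i =>
      Complex.continuous_ofReal.comp_continuousOn (continuousOn_pi.1 hw i))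
    (fun t ht => by
      rw [hasDerivWithinAt_pi]
      intro i
      have h1 := (hasDerivWithinAt_pi.1 (hd t ht) i).ofReal_comp
      refine h1.congr_deriv ?_
      simp [hMc, Matrix.mulVec, dotProduct])
    (fun t _ => by
      rw [← (IsAlgClosed.splits Mc.charpoly).eq_prod_roots_of_monic (Matrix.charpoly_monic _),
        Matrix.aeval_self_charpoly, Matrix.zero_mulVec])
    (by simpa only [hnorm] using hf) ε hε
  simpa only [hnorm] using this

/-- Solutions of `w' = M w + f` with `M` Hurwitz vanish at infinity if `f` does. -/
theorem IsHurwitz.tendsto_zero {ι : Type} [Fintype ι] [DecidableEq ι]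
    {M : Matrix ι ι ℝ} (hM : IsHurwitz M) {w f : ℝ → ι → ℝ} (hw : ContinuousOn w (Ici 0))
    (hd : ∀ t, 0 ≤ t → HasDerivWithinAt w (M *ᵥ w t + f t) (Ici t) t)
    (hf : Tendsto f atTop (𝓝 0)) : Tendsto w atTop (𝓝 0) := by
  obtain ⟨c, hc, h⟩ := hM.exists_ultimate_gain
  rw [Metric.tendsto_nhds]
  intro ε hε
  -- `c + 1` because the gain `c` may be zero.
  have hb : 0 < ε / (2 * (c + 1)) := by positivity
  have h1 := h w f _ hb.le hw hd (by
    filter_upwards [(Metric.tendsto_nhds.1 hf) _ hb] with t ht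
    simpa using ht.le) (ε / 4) (by positivity)
  filter_upwards [h1] with t ht
  rw [dist_zero_right]
  have : c * (ε / (2 * (c + 1))) ≤ ε / 2 := by
    rw [mul_div_assoc', div_le_div_iff₀ (by positivity) (by positivity)]
    nlinarith
  linarith

/-- Existence of solutions of `w' = M w + f` on `[0, ∞)`. -/
theorem exists_solution_linear_ode {ι : Type*} [Fintype ι] (M : Matrix ι ι ℝ) {f : ℝ → ι → ℝ}
    (hf : ContinuousOn f (Ici 0)) (w₀ : ι → ℝ) :
    ∃ w : ℝ → ι → ℝ, w 0 = w₀ ∧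
      ∀ t, 0 ≤ t → HasDerivWithinAt w (M *ᵥ w t + f t) (Ici 0) t := by
  let L : (ι → ℝ) →L[ℝ] (ι → ℝ) := LinearMap.toContinuousLinearMap M.mulVecLin
  let Φ : ℝ → (ι → ℝ) →L[ℝ] (ι → ℝ) := fun t => NormedSpace.exp (t • L)
  have hΦ : ∀ t, HasDerivAt Φ (L * Φ t) t := fun t => hasDerivAt_exp_smul_const' L t
  have hΦc : Continuous Φ := continuous_iff_continuousAt.2 fun t => (hΦ t).continuousAt
  have hΦinv : ∀ t, Φ t * Φ (-t) = 1 := by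
    intro t
    have hc : Commute (t • L) ((-t) • L) := ((Commute.refl L).smul_left t).smul_right (-t)
    have := NormedSpace.exp_add_of_commute_of_mem_ball (𝕂 := ℝ) hc
      ((NormedSpace.expSeries_radius_eq_top ℝ ((ι → ℝ) →L[ℝ] (ι → ℝ))).symm ▸ edist_lt_top _ _)
      ((NormedSpace.expSeries_radius_eq_top ℝ ((ι → ℝ) →L[ℝ] (ι → ℝ))).symm ▸ edist_lt_top _ _)
    rw [← add_smul, add_neg_cancel, zero_smul, NormedSpace.exp_zero] at this
    exact this.symm
  -- Continuous extension of `f` to negative times, so that the variation-of-constants integral is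
  -- differentiable at `0` too.
  let F : ℝ → ι → ℝ := fun t => f (max t 0)
  have hF : Continuous F := hf.comp_continuous (by fun_prop) fun t => mem_Ici.2 (le_max_right t 0)
  let h : ℝ → ι → ℝ := fun t => Φ (-t) (F t)
  have hh : Continuous h := (hΦc.comp continuous_neg).clm_apply hF
  refine ⟨fun t => Φ t (w₀ + ∫ s in (0 : ℝ)..t, h s), ?_, fun t ht => ?_⟩
  · simp [Φ, NormedSpace.exp_zero]
  · have h1 := (hΦ t).clm_apply ((hh.integral_hasStrictDerivAt 0 t).hasDerivAt.const_add w₀)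
    refine (h1.congr_deriv ?_).hasDerivWithinAt
    have h2 : Φ t (h t) = f t := by
      change (Φ t * Φ (-t)) (F t) = f t
      rw [hΦinv]
      simp [F, max_eq_left ht]
    rw [h2]
    rfl

/-- Uniqueness of solutions of `w' = M w + f` on `[0, ∞)`. -/
theorem eqOn_of_linear_ode {ι : Type*} [Fintype ι] (M : Matrix ι ι ℝ) {f v w : ℝ → ι → ℝ}
    (hv : ∀ t, 0 ≤ t → HasDerivWithinAt v (M *ᵥ v t + f t) (Ici 0) t)
    (hw : ∀ t, 0 ≤ t → HasDerivWithinAt w (M *ᵥ w t + f t) (Ici 0) t) (h0 : v 0 = w 0) :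
    EqOn v w (Ici 0) := by
  intro t ht
  let L : (ι → ℝ) →L[ℝ] (ι → ℝ) := LinearMap.toContinuousLinearMap M.mulVecLin
  have hL : ∀ s, LipschitzWith ‖L‖₊ fun x => M *ᵥ x + f s := fun s => by
    have := L.lipschitz.add (LipschitzWith.const (f s))
    rw [add_zero] at this
    exact this
  exact ODE_solution_unique (v := fun s x => M *ᵥ x + f s) hL
    (fun s hs => (hv s hs.1).continuousWithinAt.mono Icc_subset_Ici_self)
    (fun s hs => (hv s hs.1).mono (Ici_subset_Ici.2 hs.1))
    (fun s hs => (hw s hs.1).continuousWithinAt.mono Icc_subset_Ici_self)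
    (fun s hs => (hw s hs.1).mono (Ici_subset_Ici.2 hs.1)) h0 (right_mem_Icc.2 ht)

/-! ### Exogenous signals -/

/-- A signal with piecewise continuous derivative has a right derivative everywhere, the right
limit of the derivative. -/
theorem HasPiecewiseDeriv.exists_right_deriv {ι : Type} [Fintype ι] {ω ω' : ℝ → ι → ℝ}
    (h : HasPiecewiseDeriv ω ω') {t : ℝ} (ht : 0 ≤ t) :
    ∃ l, Tendsto ω' (𝓝[>] t) (𝓝 l) ∧ HasDerivWithinAt ω l (Ici t) t := by
  by_cases hc : ContinuousWithinAt ω' (Ici 0) t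
  · exact ⟨ω' t, hc.mono_left (nhdsWithin_mono _ fun s hs => ht.trans (le_of_lt hs)),
      (h.hasDeriv t ht hc).mono (Ici_subset_Ici.2 ht)⟩
  obtain ⟨⟨l, hl⟩, -⟩ := h.piecewise.2 t ht hc
  refine ⟨l, hl, ?_⟩
  set B := {s ∈ Icc 0 (t + 1) | ¬ ContinuousWithinAt ω' (Ici 0) s}
  have hB : B.Finite := h.piecewise.1 (t + 1)
  -- The other jumps up to `t + 1` are finitely many, hence removing them leaves a right
  -- neighbourhood of `t`. The point `t` is a jump itself and must not be removed along with them.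
  set s : Set ℝ := Ioo t (t + 1) ∩ (B \ {t})ᶜ with hs
  have hsmem : s ∈ 𝓝[>] t := by
    refine inter_mem (Ioo_mem_nhdsGT (by linarith)) (nhdsWithin_le_nhds ?_)
    exact (hB.subset sdiff_subset).isClosed.isOpen_compl.mem_nhds (by simp)
  have hderiv : ∀ r ∈ s, HasDerivAt ω (ω' r) r := by
    rintro r ⟨hr, hrB⟩
    have hr0 : 0 < r := ht.trans_lt hr.1
    have hcr : ContinuousWithinAt ω' (Ici 0) r := by
      by_contra hcr
      exact hrB ⟨⟨⟨hr0.le, hr.2.le⟩, hcr⟩, by simpa using hr.1.ne'⟩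
    exact (h.hasDeriv r hr0.le hcr).hasDerivAt (Ici_mem_nhds hr0)
  refine hasDerivWithinAt_Ici_of_tendsto_deriv (s := s)
    (fun r hr => (hderiv r hr).differentiableAt.differentiableWithinAt)
    ((h.continuousOn t ht).mono fun r hr => ht.trans hr.1.1.le) hsmem ?_
  refine hl.congr' ?_
  filter_upwards [hsmem] with r hr
  exact (hderiv r hr).deriv.symm

/-! ### Eigenvectors in real form -/

/-- The Hurwitz property in terms of the real and imaginary parts of complex eigenvectors. -/
theorem isHurwitz_iff_real {ι : Type} [Fintype ι] [DecidableEq ι] {M : Matrix ι ι ℝ} :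
    IsHurwitz M ↔ ∀ (σ τ : ℝ) (a b : ι → ℝ), M *ᵥ a = σ • a - τ • b → M *ᵥ b = τ • a + σ • b →
      (a ≠ 0 ∨ b ≠ 0) → σ < 0 := by
  set Mc : Matrix ι ι ℂ := M.map (fun r : ℝ => (r : ℂ)) with hMc
  have hmem : ∀ s : ℂ, s ∈ complexSpectrum M ↔ ∃ v : ι → ℂ, v ≠ 0 ∧ Mc *ᵥ v = s • v := by
    intro s
    rw [complexSpectrum, spectrum.mem_iff, Matrix.isUnit_iff_isUnit_det, isUnit_iff_ne_zero,
      not_not, ← Matrix.exists_mulVec_eq_zero_iff]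
    refine exists_congr fun v => and_congr_right fun _ => ?_
    rw [Matrix.sub_mulVec, Algebra.algebraMap_eq_smul_one, Matrix.smul_mulVec, Matrix.one_mulVec,
      sub_eq_zero, eq_comm]
  have hre : ∀ (v : ι → ℂ) i, ((Mc *ᵥ v) i).re = (M *ᵥ fun j => (v j).re) i := by
    intro v i
    simp [hMc, Matrix.mulVec, dotProduct]
  have him : ∀ (v : ι → ℂ) i, ((Mc *ᵥ v) i).im = (M *ᵥ fun j => (v j).im) i := by
    intro v i
    simp [hMc, Matrix.mulVec, dotProduct]
  constructor
  · intro h σ τ a b ha hb hab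
    refine h ⟨σ, τ⟩ ((hmem _).2 ⟨fun i => ⟨a i, b i⟩, ?_, ?_⟩)
    · intro h0
      rcases hab with h1 | h1
      · exact h1 (funext fun i => congrArg Complex.re (congrFun h0 i))
      · exact h1 (funext fun i => congrArg Complex.im (congrFun h0 i))
    · ext i
      refine Complex.ext ?_ ?_
      · rw [hre]
        simp [ha]
      · rw [him]
        simp [hb, add_comm]
  · intro h s hs
    obtain ⟨v, hv, hs⟩ := (hmem s).1 hs
    refine h s.re s.im (fun i => (v i).re) (fun i => (v i).im) ?_ ?_ ?_
    · ext i
      rw [← hre, hs]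
      simp
    · ext i
      rw [← him, hs]
      simp [add_comm]
    · by_contra! h0
      exact hv (funext fun i => Complex.ext (congrFun h0.1 i) (congrFun h0.2 i))

/-! ### Sylvester equations -/

/-- Solvability of the Sylvester equation `M X + B = X A₀` for `M` Hurwitz and `A₀` without
eigenvalues in the open left half plane. -/
theorem IsHurwitz.exists_sylvester {ι κ : Type} [Fintype ι] [DecidableEq ι] [Fintype κ]
    [DecidableEq κ] {M : Matrix ι ι ℝ} {A₀ : Matrix κ κ ℝ} (hM : IsHurwitz M)
    (hA₀ : NoStableEigenvalue A₀) (B : Matrix ι κ ℝ) : ∃ X : Matrix ι κ ℝ, M * X + B = X * A₀ := by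
  have hroot : ∀ {ν : Type} [Fintype ν] [DecidableEq ν] (A : Matrix ν ν ℝ) (s : ℂ),
      Polynomial.aeval s A.charpoly = 0 → s ∈ complexSpectrum A := by
    intro ν _ _ A s hs
    rw [complexSpectrum, Matrix.mem_spectrum_iff_isRoot_charpoly]
    have : A.map (fun r : ℝ => (r : ℂ)) = A.map (algebraMap ℝ ℂ) := rfl
    rw [this, Matrix.charpoly_map, Polynomial.IsRoot, Polynomial.eval_map_algebraMap, hs]
  have hcop : IsCoprime A₀.charpoly M.charpoly := by
    rw [Polynomial.isCoprime_iff_aeval_ne_zero_of_isAlgClosed ℝ ℂ]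
    intro s
    by_contra! h
    exact absurd (hM s (hroot M s h.2)) (not_lt.2 (hA₀ s (hroot A₀ s h.1)))
  obtain ⟨u, v, huv⟩ := hcop
  -- Evaluating the Bézout identity at `M` kills the `M.charpoly` term.
  have hinv : Polynomial.aeval M u * Polynomial.aeval M A₀.charpoly = 1 := by
    have := congrArg (Polynomial.aeval M) huv
    simpa [Matrix.aeval_self_charpoly] using this
  let Ψ : Matrix ι κ ℝ →ₗ[ℝ] Matrix ι κ ℝ :=
    { toFun := fun X => X * A₀ - M * X
      map_add' := fun X Y => by simp [Matrix.add_mul, Matrix.mul_add]; abel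
      map_smul' := fun c X => by simp [smul_sub] }
  -- If `X A₀ = M X`, then `X P(A₀) = P(M) X` for every polynomial `P`. With `P` the characteristic
  -- polynomial of `A₀` the left side is zero, while `P(M)` is invertible. Injectivity gives
  -- surjectivity in finite dimension.
  have hinj : Function.Injective Ψ := by
    rw [← LinearMap.ker_eq_bot, LinearMap.ker_eq_bot']
    intro X hX
    have hX : X * A₀ = M * X := sub_eq_zero.1 hX
    have hpow : ∀ k : ℕ, X * A₀ ^ k = M ^ k * X := by
      intro k
      induction k with
      | zero => simp
      | succ k ih => rw [pow_succ, ← Matrix.mul_assoc, ih, Matrix.mul_assoc, hX,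
          ← Matrix.mul_assoc, ← pow_succ]
    have hpoly : ∀ P : Polynomial ℝ, X * Polynomial.aeval A₀ P = Polynomial.aeval M P * X := by
      intro P
      induction P using Polynomial.induction_on' with
      | add P Q hP hQ => simp [Matrix.mul_add, Matrix.add_mul, hP, hQ]
      | monomial k c => simp [Polynomial.aeval_monomial, Algebra.algebraMap_eq_smul_one, hpow]
    have := hpoly A₀.charpoly
    rw [Matrix.aeval_self_charpoly, Matrix.mul_zero] at this
    rw [← Matrix.one_mul X, ← hinv, Matrix.mul_assoc, ← this, Matrix.mul_zero]
  obtain ⟨X, hX⟩ := LinearMap.injective_iff_surjective.1 hinj B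
  refine ⟨X, ?_⟩
  rw [← hX]
  change M * X + (X * A₀ - M * X) = _
  abel

/-! ### The internal model -/

/-- As `φ` kills `σ, …, β ^ (n - 1) σ`, the powers of `A₀` and `β` agree under `φ` up to exponent
`n`, and `y v` first appears at exponent `n + 1`, with coefficient one. Weighting by the
coefficients of `P`, both polynomial sums vanish and their difference is `y v`. -/
theorem eq_zero_of_internal_model_of_functional {V U : Type*} [AddCommGroup V] [Module ℝ V]
    [AddCommGroup U] [Module ℝ U] {A₀ : Module.End ℝ V} {β : Module.End ℝ U} {σ : U}
    {P : Polynomial ℝ} (hP : P.Monic) {n : ℕ} (hn : P.natDegree = n + 1)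
    (hA₀ : Polynomial.aeval A₀ P = 0) (hβ : Polynomial.aeval β P = 0)
    {φ : U →ₗ[ℝ] ℝ} (hφ : ∀ k < n, φ ((β ^ k) σ) = 0) (hφn : φ ((β ^ n) σ) = 1)
    {Z : V →ₗ[ℝ] U} {y : V → ℝ} (h : ∀ v, β (Z v) + y v • σ = Z (A₀ v)) (v : V) : y v = 0 := by
  have hstep : ∀ k v, φ ((β ^ k) (Z (A₀ v))) = φ ((β ^ (k + 1)) (Z v)) + y v * φ ((β ^ k) σ) := by
    intro k v
    rw [← h, map_add, map_add, map_smul, map_smul, smul_eq_mul, pow_succ]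
    rfl
  have hlow : ∀ k l, k + l ≤ n → ∀ v, φ ((β ^ l) (Z ((A₀ ^ k) v))) = φ ((β ^ (k + l)) (Z v)) := by
    intro k
    induction k with
    | zero => intro l _ v; simp
    | succ k ih =>
      intro l hl v
      rw [pow_succ', Module.End.mul_apply, hstep, hφ l (by omega), mul_zero, add_zero,
        ih (l + 1) (by omega)]
      congr 3
      omega
  have hlow0 : ∀ k ≤ n, ∀ v, φ (Z ((A₀ ^ k) v)) = φ ((β ^ k) (Z v)) := fun k hk v => by
    simpa using hlow k 0 (by omega) v
  have htop : φ (Z ((A₀ ^ (n + 1)) v)) = φ ((β ^ (n + 1)) (Z v)) + y v := by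
    rw [pow_succ, Module.End.mul_apply, hlow0 n le_rfl, hstep, hφn, mul_one]
  have e1 : φ (Z (Polynomial.aeval A₀ P v)) = 0 := by simp [hA₀]
  have e2 : φ (Polynomial.aeval β P (Z v)) = 0 := by simp [hβ]
  rw [Polynomial.aeval_eq_sum_range, hn, Finset.sum_range_succ] at e1 e2
  have hc : P.coeff (n + 1) = 1 := by rw [← hn]; exact hP.coeff_natDegree
  simp only [LinearMap.add_apply, LinearMap.sum_apply, LinearMap.smul_apply, map_add, map_sum,
    map_smul, hc, one_smul] at e1 e2
  rw [htop, Finset.sum_congr rfl fun k hk => by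
    rw [hlow0 k (by have := Finset.mem_range.1 hk; omega)]] at e1
  linarith

/-- The controllability matrix is square of full rank, so a covector can be prescribed on its
columns. -/
theorem IsControllable.exists_functional {n : ℕ} {β : Matrix (Fin (n + 1)) (Fin (n + 1)) ℝ}
    {σ : Fin (n + 1) → ℝ} (h : IsControllable β σ) :
    ∃ φ : (Fin (n + 1) → ℝ) →ₗ[ℝ] ℝ, (∀ k < n, φ (β ^ k *ᵥ σ) = 0) ∧ φ (β ^ n *ᵥ σ) = 1 := by
  set Q : Matrix (Fin (n + 1)) (Fin (n + 1)) ℝ :=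
    Matrix.of fun (a k : Fin (n + 1)) => ((β ^ (k : ℕ)) *ᵥ σ) a with hQ
  have hrank : Qᵀ.rank = n + 1 := by rw [Matrix.rank_transpose]; exact h
  have hsurj : LinearMap.range Qᵀ.mulVecLin = ⊤ :=
    Submodule.eq_top_of_finrank_eq (by simpa [Matrix.rank] using hrank)
  obtain ⟨c, hc⟩ := LinearMap.range_eq_top.1 hsurj (Pi.single (Fin.last n) 1)
  have hval : ∀ k : Fin (n + 1), c ⬝ᵥ (β ^ (k : ℕ) *ᵥ σ) = (Pi.single (Fin.last n) 1 : _ → ℝ) k := by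
    intro k
    rw [← hc, Matrix.mulVecLin_apply, Matrix.mulVec_transpose]
    rfl
  refine ⟨dotProductBilin ℝ ℝ c, fun k hk => ?_, ?_⟩
  · have := hval ⟨k, by omega⟩
    rw [Pi.single_eq_of_ne (by simp [Fin.ext_iff]; omega)] at this
    exact this
  · simpa using hval (Fin.last n)

/-- A controllable pair whose characteristic polynomial annihilates `A₀` cannot be driven by a
nonzero signal when it follows the trajectories of `A₀`. -/
theorem IsControllable.eq_zero_of_internal_model {s : ℕ} {β : Matrix (Fin s) (Fin s) ℝ}
    {σ : Fin s → ℝ} (hc : IsControllable β σ) {κ : Type} [Fintype κ] [DecidableEq κ]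
    {A₀ : Matrix κ κ ℝ} (hA₀ : Polynomial.aeval A₀ β.charpoly = 0)
    {Z : (κ → ℝ) →ₗ[ℝ] (Fin s → ℝ)} {y : (κ → ℝ) →ₗ[ℝ] ℝ}
    (h : ∀ v, β *ᵥ Z v + y v • σ = Z (A₀ *ᵥ v)) (v : κ → ℝ) : y v = 0 := by
  cases s with
  | zero =>
    -- For an empty block the characteristic polynomial is `1`, so annihilation of `A₀` leaves no
    -- nonzero `v`.
    have h1 : (1 : Matrix κ κ ℝ) = 0 := by simpa using hA₀
    rw [← Matrix.one_mulVec v, h1, Matrix.zero_mulVec, map_zero]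
  | succ n =>
    obtain ⟨φ, hφ, hφn⟩ := hc.exists_functional
    have hA : Polynomial.aeval (Matrix.toLinAlgEquiv' A₀) β.charpoly = 0 := by
      rw [Polynomial.aeval_algEquiv]
      simp [hA₀]
    have hB : Polynomial.aeval (Matrix.toLinAlgEquiv' β) β.charpoly = 0 := by
      rw [Polynomial.aeval_algEquiv]
      simp [Matrix.aeval_self_charpoly]
    have hpow : ∀ k, ((Matrix.toLinAlgEquiv' β) ^ k) σ = β ^ k *ᵥ σ := by
      intro k
      rw [← map_pow, Matrix.toLinAlgEquiv'_apply]
    exact eq_zero_of_internal_model_of_functional (Matrix.charpoly_monic β)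
      (n := n) (by simp [Matrix.charpoly_natDegree_eq_dim]) hA hB (σ := σ) (φ := φ)
      (fun k hk => by rw [hpow]; exact hφ k hk) (by rw [hpow]; exact hφn) (Z := Z) (y := y)
      (fun v => by simpa [Matrix.toLinAlgEquiv'_apply] using h v) v

theorem IncorporatesInternalModel.eq_zero {κ : Type} [Fintype κ] [DecidableEq κ] {p r : ℕ}
    {A₀ : Matrix κ κ ℝ} {G₁ : Matrix (Fin r) (Fin r) ℝ} {G₂ : Matrix (Fin r) (Fin p) ℝ}
    (hG : IncorporatesInternalModel A₀ G₁ G₂)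
    {Z : (κ → ℝ) →ₗ[ℝ] (Fin r → ℝ)} {y : (κ → ℝ) →ₗ[ℝ] (Fin p → ℝ)}
    (h : ∀ v, G₁ *ᵥ Z v + G₂ *ᵥ y v = Z (A₀ *ᵥ v)) (v : κ → ℝ) : y v = 0 := by
  obtain ⟨s, hs, β, σ, hG₁, hG₂, hβ⟩ := hG
  set row : (Σ l : Fin p, Fin (s l)) ≃ Fin r := finSigmaFinEquiv.trans (finCongr hs)
  ext l
  refine (hβ l).1.eq_zero_of_internal_model (A₀ := A₀) ?_
    (Z := (LinearMap.funLeft ℝ ℝ fun b => row ⟨l, b⟩).comp Z) (y := (LinearMap.proj l).comp y)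
    (fun v => ?_) v
  · rw [← (hβ l).2, minpoly.aeval]
  · ext b
    have := congrFun (h v) (row ⟨l, b⟩)
    have e1 : (G₁ *ᵥ Z v) (row ⟨l, b⟩) = (β l *ᵥ fun b => Z v (row ⟨l, b⟩)) b := by
      rw [hG₁, Matrix.mulVec, Matrix.mulVec, dotProduct, dotProduct, ← row.sum_comp,
        Fintype.sum_sigma, Finset.sum_eq_single l]
      · simp [Matrix.blockDiagonal'_apply_eq]
      · intro k _ hk
        simp [Matrix.blockDiagonal'_apply_ne _ _ _ hk.symm]
      · simp
    have e2 : (G₂ *ᵥ y v) (row ⟨l, b⟩) = y v l * σ l b := by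
      rw [hG₂, Matrix.mulVec, dotProduct, Finset.sum_eq_single l]
      · simp [mul_comm]
      · intro k _ hk
        simp [hk.symm]
      · simp
    rw [Pi.add_apply, e1, e2] at this
    exact this

/-! ### The communication graph -/

namespace AugmentedGraph

variable {N : ℕ} (𝒢 : AugmentedGraph N)

theorem deg_nonneg (i : Fin N) : 0 ≤ 𝒢.deg i :=
  Finset.sum_nonneg fun j _ => 𝒢.adj_nonneg i j

variable {𝒢}

/-- The last edge of a path from the leader to `i` has positive weight. -/
theorem HasSpanningTree.deg_add_pin_pos (h : 𝒢.HasSpanningTree) (i : Fin N) :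
    0 < 𝒢.deg i + 𝒢.pin i := by
  obtain ⟨v, -, hv⟩ := Relation.TransGen.tail'_iff.1 (h i)
  cases v with
  | none => exact add_pos_of_nonneg_of_pos (𝒢.deg_nonneg i) hv
  | some j =>
    refine add_pos_of_pos_of_nonneg ?_ (𝒢.pin_nonneg i)
    exact lt_of_lt_of_le hv (Finset.single_le_sum (f := fun j => 𝒢.adj i j)
      (fun k _ => 𝒢.adj_nonneg i k) (Finset.mem_univ j))

/-- The pinned Laplacian of a graph with a spanning tree rooted at the leader is nonsingular. -/
theorem HasSpanningTree.eq_zero (h : 𝒢.HasSpanningTree) {v : Fin N → ℝ}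
    (hv : ∀ i, ∑ j, 𝒢.adj i j * (v i - v j) + 𝒢.pin i * v i = 0) : v = 0 := by
  by_contra hne
  have : Nonempty (Fin N) := by
    by_contra hN
    rw [not_nonempty_iff] at hN
    exact hne (Subsingleton.elim _ _)
  obtain ⟨i₀, hi₀⟩ := Finite.exists_max fun i => |v i|
  have hM : 0 < |v i₀| := by
    by_contra h0
    refine hne (funext fun i => ?_)
    exact abs_nonpos_iff.1 ((hi₀ i).trans (not_lt.1 h0))
  -- Maximum principle: multiplied by `v i`, the equation at a maximiser of `|v|` is a vanishing sum
  -- of nonnegative terms. All its in-neighbours are then maximisers, and it is not pinned.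
  have hkey : ∀ i, |v i| = |v i₀| →
      (∀ j, 0 < 𝒢.adj i j → |v j| = |v i₀|) ∧ ¬ 0 < 𝒢.pin i := by
    intro i hi
    have hmul : ∑ j, 𝒢.adj i j * (v i * v i - v i * v j) + 𝒢.pin i * (v i * v i) = 0 := by
      have := congrArg (v i * ·) (hv i)
      simp only [mul_zero, mul_add, Finset.mul_sum] at this
      rw [← this]
      congr 1
      · exact Finset.sum_congr rfl fun j _ => by ring
      · ring
    have hvv : v i * v i = |v i₀| * |v i₀| := by rw [← hi, abs_mul_abs_self]
    have hle : ∀ j, v i * v j ≤ |v i₀| * |v j| := fun j => by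
      rw [← hi, ← abs_mul]; exact le_abs_self _
    have hterm : ∀ j, 0 ≤ 𝒢.adj i j * (v i * v i - v i * v j) := fun j =>
      mul_nonneg (𝒢.adj_nonneg i j) (by nlinarith [hle j, hi₀ j])
    have hpin : 0 ≤ 𝒢.pin i * (v i * v i) := mul_nonneg (𝒢.pin_nonneg i) (mul_self_nonneg _)
    have hsum := Finset.sum_nonneg fun j (_ : j ∈ Finset.univ) => hterm j
    refine ⟨fun j hj => le_antisymm (hi₀ j) ?_, fun hp => ?_⟩
    · have h0 := (Finset.sum_eq_zero_iff_of_nonneg fun j _ => hterm j).1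
        (by linarith) j (Finset.mem_univ j)
      have h1 : v i * v i - v i * v j = 0 := (mul_eq_zero.1 h0).resolve_left hj.ne'
      by_contra hlt
      nlinarith [hle j, not_le.1 hlt]
    · have : 0 < 𝒢.pin i * (v i * v i) := by rw [hvv]; positivity
      linarith
  -- Going backwards along a path, maximality spreads until it reaches a follower pinned to the
  -- leader, which is impossible.
  have hpath : ∀ u w, Relation.TransGen 𝒢.toDigraph.Adj u w → u = none →
      ∀ i, w = some i → |v i| ≠ |v i₀| := by
    intro u w huw hu
    induction huw with
    | single hadj =>
      rintro i rfl hi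
      subst hu
      exact (hkey i hi).2 hadj
    | @tail b c _ hadj ih =>
      rintro i rfl hi
      cases b with
      | none => exact (hkey i hi).2 hadj
      | some j => exact ih j rfl ((hkey i hi).1 j hadj)
  exact hpath _ _ (h i₀) rfl i₀ rfl rfl

end AugmentedGraph

/-! ### The closed loop as a single linear system -/

theorem blockDiagonal'_mulVec {o : Type*} [Fintype o] [DecidableEq o] {m n : o → Type*}
    [∀ i, Fintype (n i)] (M : (i : o) → Matrix (m i) (n i) ℝ) (v : (Σ i, n i) → ℝ)
    (i : o) (a : m i) :
    (Matrix.blockDiagonal' M *ᵥ v) ⟨i, a⟩ = (M i *ᵥ fun b => v ⟨i, b⟩) a := by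
  rw [Matrix.mulVec, Matrix.mulVec, dotProduct, dotProduct, Fintype.sum_sigma,
    Finset.sum_eq_single i]
  · simp [Matrix.blockDiagonal'_apply_eq]
  · intro k _ hk
    simp [Matrix.blockDiagonal'_apply_ne _ _ _ hk.symm]
  · simp

theorem AugmentedGraph.W_mulVec {N : ℕ} (𝒢 : AugmentedGraph N) (p : ℕ)
    (v : (Σ _ : Fin N, Fin p) → ℝ) (i : Fin N) (a : Fin p) :
    (𝒢.W p *ᵥ v) ⟨i, a⟩ =
      v ⟨i, a⟩ - 1 / (𝒢.deg i + 𝒢.pin i) * ∑ j, 𝒢.adj i j * v ⟨j, a⟩ := by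
  have h : ∀ (j : Fin N) (b : Fin p), 𝒢.W p ⟨i, a⟩ ⟨j, b⟩ =
      ((1 : Matrix (Fin N) (Fin N) ℝ) i j - 1 / (𝒢.deg i + 𝒢.pin i) * 𝒢.adj i j) *
        (1 : Matrix (Fin p) (Fin p) ℝ) a b := by
    intro j b
    simp [AugmentedGraph.W, AugmentedGraph.scaling, Matrix.diagonal_mul]
  rw [Matrix.mulVec, dotProduct, Fintype.sum_sigma]
  simp only [h, Matrix.one_apply, mul_ite, mul_one, mul_zero, ite_mul, zero_mul,
    Finset.sum_ite_eq, Finset.mem_univ, if_true, sub_mul, Finset.sum_sub_distrib,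
    one_mul, mul_assoc, Finset.mul_sum]

/-- The matrix `𝒲` is injective, separately in each output component. -/
theorem AugmentedGraph.HasSpanningTree.W_mulVec_eq_zero {N : ℕ} {𝒢 : AugmentedGraph N}
    (h : 𝒢.HasSpanningTree) {p : ℕ} {v : (Σ _ : Fin N, Fin p) → ℝ} {a : Fin p}
    (hv : ∀ i, (𝒢.W p *ᵥ v) ⟨i, a⟩ = 0) (i : Fin N) : v ⟨i, a⟩ = 0 := by
  refine congrFun (h.eq_zero (v := fun i => v ⟨i, a⟩) fun i => ?_) i
  have hpos := (h.deg_add_pin_pos i).ne'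
  have h1 := hv i
  rw [AugmentedGraph.W_mulVec] at h1
  field_simp at h1
  simp only [mul_sub, Finset.sum_sub_distrib, ← Finset.sum_mul]
  have hdeg : ∑ j, 𝒢.adj i j = 𝒢.deg i := rfl
  rw [hdeg]
  linarith

namespace Network

variable {N p qr qδ : ℕ} (S : Network N p qr qδ)

/-- The exogenous input matrix of the stacked plants. -/
noncomputable def stackedE : Matrix (Σ i, Fin (S.agent i).n) (Fin qr ⊕ Fin qδ) ℝ :=
  Matrix.of fun a => (S.agent a.1).E qr a.2

/-- The reference matrix, repeated for each agent. -/
noncomputable def stackedR : Matrix (Σ _ : Fin N, Fin p) (Fin qr ⊕ Fin qδ) ℝ :=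
  Matrix.of fun a => S.R a.2

variable {ζ : Fin N → Type} [∀ i, Fintype (ζ i)]
  (c : (i : Fin N) → OutputFeedback (S.agent i) (ζ i))

/-- The output matrix of the closed-loop system. -/
noncomputable def closedLoopOutput :
    Matrix (Σ _ : Fin N, Fin p) ((Σ i, Fin (S.agent i).n) ⊕ (Σ i, ζ i)) ℝ :=
  Matrix.fromCols S.C (S.D * Matrix.blockDiagonal' fun i => (c i).K)

/-- The exogenous input matrix of the closed-loop system. -/
noncomputable def closedLoopInput :
    Matrix ((Σ i, Fin (S.agent i).n) ⊕ (Σ i, ζ i)) (Fin qr ⊕ Fin qδ) ℝ :=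
  Matrix.fromRows S.stackedE
    (-((Matrix.blockDiagonal' fun i => (c i).M₂) * S.graph.W p * S.stackedR))

/-- The stacked state of the network. -/
noncomputable def stack (x : (i : Fin N) → ℝ → Fin (S.agent i).n → ℝ)
    (z : (i : Fin N) → ℝ → ζ i → ℝ) (t : ℝ) :
    (Σ i, Fin (S.agent i).n) ⊕ (Σ i, ζ i) → ℝ :=
  Sum.elim (fun a => x a.1 t a.2) fun a => z a.1 t a.2

variable (ω : ℝ → Fin qr ⊕ Fin qδ → ℝ)
  (x : (i : Fin N) → ℝ → Fin (S.agent i).n → ℝ) (z : (i : Fin N) → ℝ → ζ i → ℝ)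

theorem closedLoopOutput_mulVec_stack (i : Fin N) (t : ℝ) (a : Fin p) :
    (S.closedLoopOutput c *ᵥ S.stack x z t) ⟨i, a⟩ = S.output c x z i t a := by
  rw [closedLoopOutput, stack, Matrix.fromCols_mulVec_sumElim, ← Matrix.mulVec_mulVec,
    Pi.add_apply, C, D, blockDiagonal'_mulVec, blockDiagonal'_mulVec]
  simp only [blockDiagonal'_mulVec]
  rfl

theorem trackingError_apply (i : Fin N) (t : ℝ) (a : Fin p) :
    S.trackingError c ω x z i t a =
      (S.closedLoopOutput c *ᵥ S.stack x z t - S.stackedR *ᵥ ω t) ⟨i, a⟩ := by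
  rw [Pi.sub_apply, closedLoopOutput_mulVec_stack]
  rfl

variable {S} in
-- Differences of outputs are differences of tracking errors. The spanning tree ensures `d_i + k_i ≠
-- 0`, so the coefficient of agent `i`'s own error is one.
theorem virtualError_apply (hgraph : S.graph.HasSpanningTree) (i : Fin N) (t : ℝ) (a : Fin p) :
    S.virtualError c ω x z i t a = (S.graph.W p *ᵥ
      (S.closedLoopOutput c *ᵥ S.stack x z t - S.stackedR *ᵥ ω t)) ⟨i, a⟩ := by
  have hpos := (hgraph.deg_add_pin_pos i).ne'
  rw [AugmentedGraph.W_mulVec]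
  simp only [← trackingError_apply, virtualError, trackingError]
  simp only [Pi.smul_apply, Pi.add_apply, Finset.sum_apply, Pi.sub_apply, smul_eq_mul, mul_sub,
    Finset.sum_sub_distrib, ← Finset.sum_mul]
  have hdeg : ∑ j, S.graph.adj i j = S.graph.deg i := rfl
  rw [hdeg]
  field_simp
  ring

variable {S} in
theorem closedLoop_inl (i : Fin N) (t : ℝ) (a : Fin (S.agent i).n) :
    (S.closedLoopMatrix c *ᵥ S.stack x z t + S.closedLoopInput c *ᵥ ω t) (Sum.inl ⟨i, a⟩) =
      ((S.agent i).A *ᵥ x i t + (S.agent i).B *ᵥ S.input c z i t + (S.agent i).E qr *ᵥ ω t) a := by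
  simp only [closedLoopMatrix, closedLoopInput, stack, Matrix.fromBlocks_mulVec,
    Matrix.fromRows_mulVec, Pi.add_apply, Sum.elim_inl, Sum.elim_comp_inl, Sum.elim_comp_inr,
    ← Matrix.mulVec_mulVec, A, B, blockDiagonal'_mulVec]
  rfl

variable {S} in
theorem closedLoop_inr (hgraph : S.graph.HasSpanningTree) (i : Fin N) (t : ℝ) (a : ζ i) :
    (S.closedLoopMatrix c *ᵥ S.stack x z t + S.closedLoopInput c *ᵥ ω t) (Sum.inr ⟨i, a⟩) =
      ((c i).M₁ *ᵥ z i t + (c i).M₂ *ᵥ S.virtualError c ω x z i t +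
        (c i).M₃ *ᵥ S.measurement c x z i t) a := by
  have hv : S.virtualError c ω x z i t = fun a => (S.graph.W p *ᵥ
      (S.closedLoopOutput c *ᵥ S.stack x z t - S.stackedR *ᵥ ω t)) ⟨i, a⟩ :=
    funext (virtualError_apply c ω x z hgraph i t)
  have hm : S.measurement c x z i t = fun a => (S.Cm *ᵥ (fun b => x b.1 t b.2) +
      S.Dm *ᵥ ((Matrix.blockDiagonal' fun i => (c i).K) *ᵥ fun b => z b.1 t b.2)) ⟨i, a⟩ := by
    ext a
    simp only [Pi.add_apply, Cm, Dm, blockDiagonal'_mulVec]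
    rfl
  rw [hv, hm]
  change _ = ((c i).M₁ *ᵥ fun b => z i t b) a + ((c i).M₂ *ᵥ _) a + ((c i).M₃ *ᵥ _) a
  rw [← blockDiagonal'_mulVec (fun i => (c i).M₁) (fun b => z b.1 t b.2),
    ← blockDiagonal'_mulVec (fun i => (c i).M₂), ← blockDiagonal'_mulVec (fun i => (c i).M₃)]
  simp only [closedLoopMatrix, closedLoopInput, closedLoopOutput, stack, Matrix.fromBlocks_mulVec,
    Matrix.fromRows_mulVec, Matrix.fromCols_mulVec_sumElim, Sum.elim_inr, Sum.elim_comp_inl,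
    Sum.elim_comp_inr, ← Matrix.mulVec_mulVec, Matrix.add_mulVec, Matrix.mulVec_add,
    Matrix.mulVec_sub, Matrix.neg_mulVec, Pi.add_apply, Pi.sub_apply, Pi.neg_apply]
  ring

variable {S} in
theorem isTrajectory_iff (hgraph : S.graph.HasSpanningTree) :
    S.IsTrajectory c ω x z ↔ ∀ t, 0 ≤ t → HasDerivWithinAt (S.stack x z)
      (S.closedLoopMatrix c *ᵥ S.stack x z t + S.closedLoopInput c *ᵥ ω t) (Ici 0) t := by
  constructor
  · intro h t ht
    rw [hasDerivWithinAt_pi]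
    rintro (⟨i, a⟩ | ⟨i, a⟩)
    · rw [closedLoop_inl]
      exact hasDerivWithinAt_pi.1 (h.plant i t ht) a
    · rw [closedLoop_inr c ω x z hgraph]
      exact hasDerivWithinAt_pi.1 (h.controller i t ht) a
  · refine fun h => ⟨fun i t ht => ?_, fun i t ht => ?_⟩
    · rw [hasDerivWithinAt_pi]
      intro a
      rw [← closedLoop_inl]
      exact hasDerivWithinAt_pi.1 (h t ht) (Sum.inl ⟨i, a⟩)
    · rw [hasDerivWithinAt_pi]
      intro a
      rw [← closedLoop_inr c ω x z hgraph]
      exact hasDerivWithinAt_pi.1 (h t ht) (Sum.inr ⟨i, a⟩)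

end Network

namespace Network

variable {N p qr qδ : ℕ} {S : Network N p qr qδ}

/-! ### Properties that hold for every output feedback -/

section OutputFeedback

variable {ζ : Fin N → Type} [∀ i, Fintype (ζ i)]
  {c : (i : Fin N) → OutputFeedback (S.agent i) (ζ i)}
  {ω ω' : ℝ → Fin qr ⊕ Fin qδ → ℝ}

theorem exists_isTrajectory (hgraph : S.graph.HasSpanningTree) (hω : ContinuousOn ω (Ici 0))
    (x₀ : (i : Fin N) → Fin (S.agent i).n → ℝ) (z₀ : (i : Fin N) → ζ i → ℝ) :
    ∃ x z, S.IsTrajectory c ω x z ∧ (∀ i, x i 0 = x₀ i) ∧ (∀ i, z i 0 = z₀ i) := by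
  obtain ⟨w, hw0, hw⟩ := exists_solution_linear_ode (S.closedLoopMatrix c)
    (continuousOn_mulVec (S.closedLoopInput c) hω)
    (Sum.elim (fun a => x₀ a.1 a.2) fun a => z₀ a.1 a.2)
  have hstack : S.stack (fun i t a => w t (Sum.inl ⟨i, a⟩)) (fun i t a => w t (Sum.inr ⟨i, a⟩))
      = w := by
    ext t (⟨i, a⟩ | ⟨i, a⟩) <;> rfl
  refine ⟨fun i t a => w t (Sum.inl ⟨i, a⟩), fun i t a => w t (Sum.inr ⟨i, a⟩), ?_, ?_, ?_⟩
  · rw [isTrajectory_iff c ω _ _ hgraph, hstack]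
    exact hw
  · intro i
    ext a
    simp [hw0]
  · intro i
    ext a
    simp [hw0]

theorem IsTrajectory.stack_eqOn (hgraph : S.graph.HasSpanningTree)
    {x x' : (i : Fin N) → ℝ → Fin (S.agent i).n → ℝ} {z z' : (i : Fin N) → ℝ → ζ i → ℝ}
    (h : S.IsTrajectory c ω x z) (h' : S.IsTrajectory c ω x' z')
    (hx : ∀ i, x i 0 = x' i 0) (hz : ∀ i, z i 0 = z' i 0) :
    EqOn (S.stack x z) (S.stack x' z') (Ici 0) := by
  refine eqOn_of_linear_ode (S.closedLoopMatrix c)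
    ((isTrajectory_iff c ω x z hgraph).1 h) ((isTrajectory_iff c ω x' z' hgraph).1 h') ?_
  ext (⟨i, a⟩ | ⟨i, a⟩)
  · exact congrFun (hx i) a
  · exact congrFun (hz i) a

variable {A₀ : Matrix (Fin qr ⊕ Fin qδ) (Fin qr ⊕ Fin qδ) ℝ}
  {X : Matrix ((Σ i, Fin (S.agent i).n) ⊕ (Σ i, ζ i)) (Fin qr ⊕ Fin qδ) ℝ}

/-- The deviation from the steady state `X ω` given by a solution `X` of the Sylvester equation
is driven by `A₀ ω - ω'`. -/
theorem IsTrajectory.hasDerivWithinAt_deviation (hgraph : S.graph.HasSpanningTree)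
    {x : (i : Fin N) → ℝ → Fin (S.agent i).n → ℝ} {z : (i : Fin N) → ℝ → ζ i → ℝ}
    (h : S.IsTrajectory c ω x z)
    (hX : S.closedLoopMatrix c * X + S.closedLoopInput c = X * A₀) {t : ℝ} (ht : 0 ≤ t)
    {l : Fin qr ⊕ Fin qδ → ℝ} (hl : HasDerivWithinAt ω l (Ici t) t) :
    HasDerivWithinAt (fun t => S.stack x z t - X *ᵥ ω t)
      (S.closedLoopMatrix c *ᵥ (S.stack x z t - X *ᵥ ω t) + X *ᵥ (A₀ *ᵥ ω t - l)) (Ici t) t := by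
  have h1 := ((isTrajectory_iff c ω x z hgraph).1 h t ht).mono (Ici_subset_Ici.2 ht)
  refine (h1.fun_sub (hasDerivWithinAt_mulVec X hl)).congr_deriv ?_
  have h2 := congrArg (· *ᵥ ω t) hX
  simp only [Matrix.add_mulVec, ← Matrix.mulVec_mulVec] at h2
  rw [Matrix.mulVec_sub, Matrix.mulVec_sub, ← h2]
  abel

theorem IsTrajectory.continuousOn_deviation (hgraph : S.graph.HasSpanningTree)
    {x : (i : Fin N) → ℝ → Fin (S.agent i).n → ℝ} {z : (i : Fin N) → ℝ → ζ i → ℝ}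
    (h : S.IsTrajectory c ω x z) (hω : ContinuousOn ω (Ici 0)) :
    ContinuousOn (fun t => S.stack x z t - X *ᵥ ω t) (Ici 0) :=
  ContinuousOn.sub
    (fun t ht => ((isTrajectory_iff c ω x z hgraph).1 h t ht).continuousWithinAt)
    (continuousOn_mulVec X hω)

theorem stack_trackingError
    (hXR : S.closedLoopOutput c * X = S.stackedR)
    (x : (i : Fin N) → ℝ → Fin (S.agent i).n → ℝ) (z : (i : Fin N) → ℝ → ζ i → ℝ)
    (i : Fin N) (t : ℝ) (a : Fin p) :
    S.trackingError c ω x z i t a =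
      (S.closedLoopOutput c *ᵥ (S.stack x z t - X *ᵥ ω t)) ⟨i, a⟩ := by
  rw [trackingError_apply, Matrix.mulVec_sub, Matrix.mulVec_mulVec, hXR]

/-- A stabilizing output feedback solves the regulation problem if the regulator equations are
solvable. -/
theorem solvesRegulation_of_regulator_equations [∀ i, DecidableEq (ζ i)]
    (hgraph : S.graph.HasSpanningTree)
    (hω : IsAdmissibleSignal A₀ ω ω') (hH : IsHurwitz (S.closedLoopMatrix c))
    (hX : S.closedLoopMatrix c * X + S.closedLoopInput c = X * A₀)
    (hXR : S.closedLoopOutput c * X = S.stackedR) : S.SolvesRegulation c A₀ ω ω' := by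
  obtain ⟨hpw, κ, hκ, hκb⟩ := hω
  -- At a jump `ω'` need not be a derivative of `ω`. Its right limit `ρ` is a right derivative at
  -- every `t ≥ 0`, and `hclosed` carries bounds over from `ω'` to `ρ`.
  choose! ρ hρ hρd using fun t (ht : 0 ≤ t) => hpw.exists_right_deriv ht
  have hlim : ∀ t, 0 ≤ t →
      Tendsto (fun s => A₀ *ᵥ ω s - ω' s) (𝓝[>] t) (𝓝 (A₀ *ᵥ ω t - ρ t)) := by
    intro t ht
    refine Tendsto.sub ?_ (hρ t ht)
    exact (continuousOn_mulVec A₀ hpw.continuousOn t ht).mono_left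
      (nhdsWithin_mono _ fun s hs => ht.trans (le_of_lt hs))
  have hclosed : ∀ T r, 0 ≤ T → (∀ t, T ≤ t → ‖A₀ *ᵥ ω t - ω' t‖ ≤ r) →
      ∀ t, T ≤ t → ‖A₀ *ᵥ ω t - ρ t‖ ≤ r := by
    intro T r hT hr t ht
    refine le_of_tendsto (hlim t (hT.trans ht)).norm ?_
    filter_upwards [self_mem_nhdsWithin] with s hs
    exact hr s (ht.trans (le_of_lt hs))
  have hsup : ∀ {ν : Type} [Fintype ν] (v : ν → ℝ), ‖v‖ ≤ norm2 v := by
    intro ν _ v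
    exact (pi_norm_le_iff_of_nonneg (norm_nonneg _)).2 fun i =>
      PiLp.norm_apply_le (WithLp.toLp 2 v : EuclideanSpace ℝ ν) i
  refine ⟨hH, exists_isTrajectory hgraph hpw.continuousOn, ?_, ?_⟩
  · obtain ⟨γ, hγ, hgain⟩ := hH.exists_ultimate_gain
    obtain ⟨k, hk, hkX⟩ := exists_norm_mulVec_le X
    obtain ⟨m, hm, hmC⟩ := exists_norm_mulVec_le (S.closedLoopOutput c)
    obtain ⟨d, hd, hdn⟩ : ∃ d : ℝ, 0 ≤ d ∧ ∀ v : Fin p → ℝ, norm2 v ≤ d * ‖v‖ :=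
      ⟨_, norm_nonneg _, ((EuclideanSpace.equiv (Fin p) ℝ).symm.toContinuousLinearMap).le_opNorm⟩
    -- The factors bound, from the inside out, the signal mismatch, `X`, the gain of the loop, the
    -- output map and the passage from sup to Euclidean norm. The inner `1` is the slack `ε`; the
    -- outer one makes the bound positive.
    refine ⟨d * (m * (γ * (k * κ) + 1)) + 1, by positivity, fun x₀ z₀ => ?_⟩
    -- `T` must be chosen before the trajectory: it is read off one solution, and uniqueness
    -- transfers the bound to all others with these initial data.
    obtain ⟨x', z', htr', hx', hz'⟩ := exists_isTrajectory (c := c) hgraph hpw.continuousOn x₀ z₀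
    have hult := hgain (fun t => S.stack x' z' t - X *ᵥ ω t) (fun t => X *ᵥ (A₀ *ᵥ ω t - ρ t))
      (k * κ) (by positivity) (htr'.continuousOn_deviation hgraph hpw.continuousOn)
      (fun t ht => htr'.hasDerivWithinAt_deviation hgraph hX ht (hρd t ht))
      (by
        filter_upwards [eventually_ge_atTop 0] with t ht
        exact (hkX _).trans (mul_le_mul_of_nonneg_left
          (hclosed 0 κ le_rfl (fun s hs => (hsup _).trans (hκb s hs)) t ht) hk)) 1 one_pos
    obtain ⟨T, hT⟩ := eventually_atTop.1 hult
    refine ⟨max T 0, le_max_right _ _, fun x z htr hx hz t ht i => ?_⟩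
    have heq := htr.stack_eqOn hgraph htr' (fun i => (hx i).trans (hx' i).symm)
      (fun i => (hz i).trans (hz' i).symm) ((le_max_right _ _).trans ht : (0 : ℝ) ≤ t)
    have h1 := hT t ((le_max_left _ _).trans ht)
    have h2 : ‖S.trackingError c ω x z i t‖ ≤ m * (γ * (k * κ) + 1) := by
      refine (pi_norm_le_iff_of_nonneg (by positivity)).2 fun a => ?_
      rw [stack_trackingError hXR, heq]
      exact (norm_le_pi_norm _ _).trans ((hmC _).trans (mul_le_mul_of_nonneg_left h1 hm))
    have := (hdn _).trans (mul_le_mul_of_nonneg_left h2 hd)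
    linarith
  · intro h0 x z htr i
    have hρ0 : Tendsto (fun t => A₀ *ᵥ ω t - ρ t) atTop (𝓝 0) := by
      rw [Metric.tendsto_atTop] at h0 ⊢
      intro ε hε
      obtain ⟨T, hT⟩ := h0 (ε / 2) (half_pos hε)
      refine ⟨max T 0, fun t ht => ?_⟩
      rw [dist_zero_right]
      refine (hclosed (max T 0) (ε / 2) (le_max_right _ _) (fun s hs => ?_) t ht).trans_lt
        (half_lt_self hε)
      have := hT s ((le_max_left _ _).trans hs)
      rw [dist_zero_right] at this
      exact this.le
    have hcont : ∀ {m n : Type} [Fintype m] [Fintype n] (M : Matrix m n ℝ) {w : ℝ → n → ℝ},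
        Tendsto w atTop (𝓝 0) → Tendsto (fun t => M *ᵥ w t) atTop (𝓝 0) := by
      intro m n _ _ M w hw
      have := ((LinearMap.toContinuousLinearMap M.mulVecLin).continuous.tendsto 0).comp hw
      rwa [map_zero] at this
    have hdev := hH.tendsto_zero (htr.continuousOn_deviation (X := X) hgraph hpw.continuousOn)
      (fun t ht => htr.hasDerivWithinAt_deviation hgraph hX ht (hρd t ht)) (hcont X hρ0)
    rw [tendsto_pi_nhds]
    intro a
    simp only [stack_trackingError hXR]
    exact tendsto_pi_nhds.1 (hcont (S.closedLoopOutput c) hdev) ⟨i, a⟩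

end OutputFeedback

/-! ### The observer-based law -/

variable {g : (i : Fin N) → Gains (S.agent i)}

/-- Viewing `ξ` and `v` as constant signals turns the trajectory formulas into matrix identities.
This serves both the steady state `X v` and the state-feedback reduction. -/
theorem toFeedback_internal_model (hgraph : S.graph.HasSpanningTree)
    (ξ : (Σ i, Fin (S.agent i).n) ⊕ (Σ i, Fin (S.agent i).n ⊕ Fin (g i).r) → ℝ)
    (v : Fin qr ⊕ Fin qδ → ℝ) (i : Fin N) :
    (fun a => (S.closedLoopMatrix (fun i => (g i).toFeedback) *ᵥ ξ +
        S.closedLoopInput (fun i => (g i).toFeedback) *ᵥ v) (Sum.inr ⟨i, Sum.inr a⟩)) =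
      (g i).G₁ *ᵥ (fun a => ξ (Sum.inr ⟨i, Sum.inr a⟩)) + (g i).G₂ *ᵥ fun b => (S.graph.W p *ᵥ
        (S.closedLoopOutput (fun i => (g i).toFeedback) *ᵥ ξ - S.stackedR *ᵥ v)) ⟨i, b⟩ := by
  set x : (i : Fin N) → ℝ → Fin (S.agent i).n → ℝ := fun i _ k => ξ (Sum.inl ⟨i, k⟩)
  set z : (i : Fin N) → ℝ → Fin (S.agent i).n ⊕ Fin (g i).r → ℝ :=
    fun i _ k => ξ (Sum.inr ⟨i, k⟩) with hz
  have hstack : S.stack x z 0 = ξ := by ext (⟨i, k⟩ | ⟨i, k⟩) <;> rfl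
  have h1 := closedLoop_inr (fun i => (g i).toFeedback) (fun _ => v) x z hgraph i 0
  have h2 := funext (virtualError_apply (fun i => (g i).toFeedback) (fun _ => v) x z hgraph i 0)
  rw [hstack] at h1 h2
  ext a
  rw [h1, h2]
  simp [Gains.toFeedback, Matrix.fromBlocks_mulVec, Matrix.fromRows_mulVec, hz,
    Function.comp_def]

/-- In the difference of the observer and plant rows the input terms cancel, and the virtual error
does not enter the observer. -/
theorem toFeedback_observer_error (hgraph : S.graph.HasSpanningTree)
    {ξ η : (Σ i, Fin (S.agent i).n) ⊕ (Σ i, Fin (S.agent i).n ⊕ Fin (g i).r) → ℝ}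
    (h : S.closedLoopMatrix (fun i => (g i).toFeedback) *ᵥ ξ = η) (i : Fin N) :
    ((S.agent i).A - (g i).H * (S.agent i).Cm) *ᵥ
        (fun a => ξ (Sum.inr ⟨i, Sum.inl a⟩) - ξ (Sum.inl ⟨i, a⟩)) =
      fun a => η (Sum.inr ⟨i, Sum.inl a⟩) - η (Sum.inl ⟨i, a⟩) := by
  set x : (i : Fin N) → ℝ → Fin (S.agent i).n → ℝ := fun i _ k => ξ (Sum.inl ⟨i, k⟩) with hx
  set z : (i : Fin N) → ℝ → Fin (S.agent i).n ⊕ Fin (g i).r → ℝ :=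
    fun i _ k => ξ (Sum.inr ⟨i, k⟩) with hz
  have hstack : S.stack x z 0 = ξ := by ext (⟨i, k⟩ | ⟨i, k⟩) <;> rfl
  have h1 := closedLoop_inr (fun i => (g i).toFeedback) (fun _ => 0) x z hgraph i 0
  have h2 := closedLoop_inl (fun i => (g i).toFeedback) (fun _ => 0) x z i 0
  rw [hstack, Matrix.mulVec_zero, add_zero, h] at h1 h2
  have e1 : (fun a => ξ (Sum.inr ⟨i, Sum.inl a⟩) - ξ (Sum.inl ⟨i, a⟩)) =
      z i 0 ∘ Sum.inl - x i 0 := rfl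
  rw [e1]
  ext a
  rw [h1, h2]
  simp only [Gains.toFeedback, measurement, input, Matrix.fromBlocks_mulVec,
    Matrix.fromRows_mulVec, Matrix.fromCols_mulVec, Matrix.mulVec_zero, Matrix.zero_mulVec,
    Pi.add_apply, Pi.sub_apply, Pi.zero_apply, Sum.elim_inl, Matrix.add_mulVec,
    Matrix.sub_mulVec, Matrix.mul_add, Matrix.sub_mul,
    ← Matrix.mulVec_mulVec, Matrix.mulVec_add, Matrix.mulVec_sub]
  ring

/-- When every estimate equals the state, the law becomes the state feedback `K₁ x + K₂ z̄` that
defines `A_g`. -/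
theorem toFeedback_state_feedback (hgraph : S.graph.HasSpanningTree)
    {ξ η : (Σ i, Fin (S.agent i).n) ⊕ (Σ i, Fin (S.agent i).n ⊕ Fin (g i).r) → ℝ}
    (h : S.closedLoopMatrix (fun i => (g i).toFeedback) *ᵥ ξ = η)
    (hξ : ∀ i a, ξ (Sum.inr ⟨i, Sum.inl a⟩) = ξ (Sum.inl ⟨i, a⟩)) :
    S.Ag g *ᵥ Sum.elim (fun a => ξ (Sum.inl a)) (fun b => ξ (Sum.inr ⟨b.1, Sum.inr b.2⟩)) =
      Sum.elim (fun a => η (Sum.inl a)) fun b => η (Sum.inr ⟨b.1, Sum.inr b.2⟩) := by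
  set x : (i : Fin N) → ℝ → Fin (S.agent i).n → ℝ := fun i _ k => ξ (Sum.inl ⟨i, k⟩) with hx
  set z : (i : Fin N) → ℝ → Fin (S.agent i).n ⊕ Fin (g i).r → ℝ :=
    fun i _ k => ξ (Sum.inr ⟨i, k⟩) with hz
  have hstack : S.stack x z 0 = ξ := by ext (⟨i, k⟩ | ⟨i, k⟩) <;> rfl
  have hzx : ∀ i, z i 0 ∘ Sum.inl = x i 0 := fun i => funext fun k => hξ i k
  have hinput : ∀ i, S.input (fun i => (g i).toFeedback) z i 0 =
      (g i).K₁ *ᵥ x i 0 + (g i).K₂ *ᵥ (z i 0 ∘ Sum.inr) := fun i => by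
    rw [input, Gains.toFeedback, Matrix.fromCols_mulVec, hzx]
  have hout : S.closedLoopOutput (fun i => (g i).toFeedback) *ᵥ ξ =
      S.C *ᵥ (fun a => ξ (Sum.inl a)) +
      S.D *ᵥ ((Matrix.blockDiagonal' fun i => (g i).K₁) *ᵥ (fun a => ξ (Sum.inl a)) +
        (Matrix.blockDiagonal' fun i => (g i).K₂) *ᵥ
          fun b => ξ (Sum.inr ⟨b.1, Sum.inr b.2⟩)) := by
    ext ⟨i, a⟩
    have h1 := closedLoopOutput_mulVec_stack S (fun i => (g i).toFeedback) x z i 0 a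
    rw [hstack] at h1
    rw [h1, output, hinput, Pi.add_apply, Pi.add_apply, C, D, blockDiagonal'_mulVec,
      blockDiagonal'_mulVec]
    simp only [Pi.add_apply, blockDiagonal'_mulVec]
    rfl
  ext (⟨i, a⟩ | ⟨i, a⟩)
  · have h2 := closedLoop_inl (fun i => (g i).toFeedback) (fun _ => 0) x z i 0 a
    rw [hstack, Matrix.mulVec_zero, add_zero, h, hinput] at h2
    rw [Sum.elim_inl, h2]
    simp only [Ag, Matrix.fromBlocks_mulVec, Sum.elim_inl, Sum.elim_comp_inl, Sum.elim_comp_inr,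
      Matrix.add_mulVec, Matrix.mulVec_add, Matrix.mulVec_zero, ← Matrix.mulVec_mulVec,
      Pi.add_apply, Pi.zero_apply, A, B, blockDiagonal'_mulVec, add_zero, ← add_assoc]
    rfl
  · have h2 := congrFun (toFeedback_internal_model hgraph ξ 0 i) a
    simp only [Matrix.mulVec_zero, add_zero, sub_zero, h] at h2
    rw [Sum.elim_inr, h2, hout, Pi.add_apply,
      ← blockDiagonal'_mulVec (fun i => (g i).G₁)
        (fun b => ξ (Sum.inr ⟨b.1, Sum.inr b.2⟩)),
      ← blockDiagonal'_mulVec (fun i => (g i).G₂)]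
    simp only [Ag, Matrix.fromBlocks_mulVec, Sum.elim_inr, Sum.elim_comp_inl, Sum.elim_comp_inr,
      Matrix.add_mulVec, Matrix.mulVec_add, ← Matrix.mulVec_mulVec, Pi.add_apply]
    ring

theorem isHurwitz_closedLoopMatrix (hgraph : S.graph.HasSpanningTree)
    (hAg : IsHurwitz (S.Ag g))
    (hAH : ∀ i, IsHurwitz ((S.agent i).A - (g i).H * (S.agent i).Cm)) :
    IsHurwitz (S.closedLoopMatrix fun i => (g i).toFeedback) := by
  rw [isHurwitz_iff_real]
  intro σ τ a b ha hb hab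
  by_contra hσ
  -- The observer-error parts of `a` and `b` satisfy the same eigenvector relations for `A_i - H_i
  -- C_mi`; as `σ ≥ 0`, they vanish.
  have hobs : ∀ i, (fun k => a (Sum.inr ⟨i, Sum.inl k⟩) - a (Sum.inl ⟨i, k⟩)) = 0 ∧
      (fun k => b (Sum.inr ⟨i, Sum.inl k⟩) - b (Sum.inl ⟨i, k⟩)) = 0 := by
    intro i
    by_contra hne
    refine hσ (isHurwitz_iff_real.1 (hAH i) σ τ _ _ ?_ ?_ (not_and_or.1 hne))
    · rw [toFeedback_observer_error hgraph ha]
      ext k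
      simp
      ring
    · rw [toFeedback_observer_error hgraph hb]
      ext k
      simp
      ring
  have ha0 : ∀ i k, a (Sum.inr ⟨i, Sum.inl k⟩) = a (Sum.inl ⟨i, k⟩) := fun i k =>
    sub_eq_zero.1 (congrFun (hobs i).1 k)
  have hb0 : ∀ i k, b (Sum.inr ⟨i, Sum.inl k⟩) = b (Sum.inl ⟨i, k⟩) := fun i k =>
    sub_eq_zero.1 (congrFun (hobs i).2 k)
  have hzero : ∀ {ξ : (Σ i, Fin (S.agent i).n) ⊕ (Σ i, Fin (S.agent i).n ⊕ Fin (g i).r) → ℝ},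
      (∀ i k, ξ (Sum.inr ⟨i, Sum.inl k⟩) = ξ (Sum.inl ⟨i, k⟩)) →
      (Sum.elim (fun a => ξ (Sum.inl a)) (fun b => ξ (Sum.inr ⟨b.1, Sum.inr b.2⟩)) :
        (Σ i, Fin (S.agent i).n) ⊕ (Σ i, Fin (g i).r) → ℝ) = 0 → ξ = 0 := by
    intro ξ hξ h0
    have hinl : ∀ i k, ξ (Sum.inl ⟨i, k⟩) = 0 := fun i k => congrFun h0 (Sum.inl ⟨i, k⟩)
    ext (⟨i, k⟩ | ⟨i, k | k⟩)
    · exact hinl i k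
    · exact (hξ i k).trans (hinl i k)
    · exact congrFun h0 (Sum.inr ⟨i, k⟩)
  refine hσ (isHurwitz_iff_real.1 hAg σ τ _ _ ((toFeedback_state_feedback hgraph ha ha0).trans ?_)
    ((toFeedback_state_feedback hgraph hb hb0).trans ?_)
    (hab.imp (mt (hzero ha0)) (mt (hzero hb0))))
  · ext (⟨i, k⟩ | ⟨i, k⟩) <;> simp
  · ext (⟨i, k⟩ | ⟨i, k⟩) <;> simp

/-- With an internal model, every solution of the Sylvester equation satisfies the regulator
equations. -/
theorem regulator_equations_of_internal_model (hgraph : S.graph.HasSpanningTree)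
    {A₀ : Matrix (Fin qr ⊕ Fin qδ) (Fin qr ⊕ Fin qδ) ℝ}
    (hmodel : ∀ i, IncorporatesInternalModel A₀ (g i).G₁ (g i).G₂)
    {X : Matrix ((Σ i, Fin (S.agent i).n) ⊕ (Σ i, Fin (S.agent i).n ⊕ Fin (g i).r))
      (Fin qr ⊕ Fin qδ) ℝ}
    (hX : S.closedLoopMatrix (fun i => (g i).toFeedback) * X +
      S.closedLoopInput (fun i => (g i).toFeedback) = X * A₀) :
    S.closedLoopOutput (fun i => (g i).toFeedback) * X = S.stackedR := by
  -- `Y *ᵥ v` is the stacked virtual error at the steady state `X *ᵥ v`; it is the input of the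
  -- internal models.
  obtain ⟨Y, hY⟩ : ∃ Y, Y = S.graph.W p *
    (S.closedLoopOutput (fun i => (g i).toFeedback) * X - S.stackedR) := ⟨_, rfl⟩
  have hdyn : ∀ i v, (g i).G₁ *ᵥ (fun a => (X *ᵥ v) (Sum.inr ⟨i, Sum.inr a⟩)) +
      (g i).G₂ *ᵥ (fun b => (Y *ᵥ v) ⟨i, b⟩) =
      fun a => (X *ᵥ (A₀ *ᵥ v)) (Sum.inr ⟨i, Sum.inr a⟩) := by
    intro i v
    have h1 := toFeedback_internal_model hgraph (X *ᵥ v) v i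
    rw [Matrix.mulVec_mulVec, Matrix.mulVec_mulVec, ← Matrix.add_mulVec, hX,
      ← Matrix.sub_mulVec, Matrix.mulVec_mulVec, ← Matrix.mulVec_mulVec, ← hY] at h1
    exact h1.symm
  have hker : ∀ i v b, (Y *ᵥ v) ⟨i, b⟩ = 0 := by
    intro i v b
    let Z : (Fin qr ⊕ Fin qδ → ℝ) →ₗ[ℝ] (Fin (g i).r → ℝ) :=
      LinearMap.pi fun a => (LinearMap.proj (Sum.inr ⟨i, Sum.inr a⟩)).comp X.mulVecLin
    let y : (Fin qr ⊕ Fin qδ → ℝ) →ₗ[ℝ] (Fin p → ℝ) :=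
      LinearMap.pi fun b => (LinearMap.proj ⟨i, b⟩).comp Y.mulVecLin
    exact congrFun ((hmodel i).eq_zero (Z := Z) (y := y) (hdyn i) v) b
  rw [← sub_eq_zero]
  refine Matrix.ext_of_mulVec_single fun j => ?_
  rw [Matrix.zero_mulVec]
  ext ⟨i, b⟩
  exact hgraph.W_mulVec_eq_zero (fun i => by rw [Matrix.mulVec_mulVec, ← hY]; exact hker i _ b) i

end Network

end CoopReg

theorem theorem3 {N p qr qδ : ℕ} (S : CoopReg.Network N p qr qδ)
    (A₀ : Matrix (Fin qr ⊕ Fin qδ) (Fin qr ⊕ Fin qδ) ℝ)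
    (ω ω' : ℝ → Fin qr ⊕ Fin qδ → ℝ)
    (g : (i : Fin N) → CoopReg.Gains (S.agent i))
    (hA₀ : CoopReg.NoStableEigenvalue A₀)
    (hω : CoopReg.IsAdmissibleSignal A₀ ω ω')
    (hgraph : S.graph.HasSpanningTree)
    (hmodel : ∀ i, CoopReg.IncorporatesInternalModel A₀ (g i).G₁ (g i).G₂)
    (hAg : CoopReg.IsHurwitz (S.Ag g))
    (hAH : ∀ i, CoopReg.IsHurwitz ((S.agent i).A - (g i).H * (S.agent i).Cm)) :
    S.SolvesRegulation (fun i => (g i).toFeedback) A₀ ω ω' := by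
  have hH := CoopReg.Network.isHurwitz_closedLoopMatrix hgraph hAg hAH
  obtain ⟨X, hX⟩ := hH.exists_sylvester hA₀ (S.closedLoopInput fun i => (g i).toFeedback)
  exact CoopReg.Network.solvesRegulation_of_regulator_equations hgraph hω hH hX
    (CoopReg.Network.regulator_equations_of_internal_model hgraph hmodel hX)
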